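/- **Theorem.** Let $n\ge 1$, let $\tau\in\mathbb H$ (upper half-plane), put $\Lambda_\tau=\mathbb Z+\mathbb Z\tau$, and let $\kappa\in\mathbb C\setminus\Lambda_\tau$. For $a,b\in\mathbb Q$ put $$\theta_{a,b}(z,\tau)=\sum_{m\in\mathbb Z}e^{\pi i(m+a)^2\tau+2\pi i(m+a)(z+b)},\qquad \theta(z)=\vartheta_1(z,\tau)=-\theta_{\frac12,\frac12}(z,\tau),\qquad G(z,\mu)=\frac{\theta'(0)\,\theta(z+\mu)}{\theta(z)\,\theta(\mu)}.$$ On the field $\mathcal M(\mathbb C^2)$ of meromorphic functions in $(z_1,z_2)$ let $(Pf)(z_1,z_2)=f(z_2,z_1)$ and $(\tilde{\mathcal F}_sf)(z_1,z_2)=f(z_1+s,z_2-s)$. For $\lambda\in\mathbb C\setminus\Lambda_\tau$ let $$\mathcal R^e(\lambda)=G(z_1-z_2,\lambda)P-G(z_1-z_2,\kappa)I,\qquad \mathcal R^e_{\alpha,\beta}(\lambda)=\tilde{\mathcal F}_{-\alpha\lambda-\beta}\,\mathcal R^e(\lambda)\,\tilde{\mathcal F}_{\alpha\lambda-\beta}$$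 be the elliptic Shibukawa–Ueno operator and its twists. Let $V^e_n$ be the space of entire functions $f$ on $\mathbb C$ with $$f(z+1)=(-1)^{n-1}f(z),\qquad f(z+\tau)=e^{-\pi i n\tau-2\pi i n z}f(z),$$ and identify $V^e_n\otimes V^e_n$ with the span of the functions $f(z_1)g(z_2)$, $f,g\in V^e_n$, in $\mathcal M(\mathbb C^2)$. For $a\in\mathbb Z/n$ let $$\psi_a(z)=\sum_{m\equiv a\,(n)}e^{\pi i(m-\frac{n-1}2)^2\tau/n+2\pi i(m-\frac{n-1}2)z}.$$ Then $\{\psi_a\}_{a\in\mathbb Z/n}$ is a basis of $V^e_n$, $\{\psi_a\otimes\psi_b\}$ is a basis of $V^e_n\otimes V^e_n$, and the following hold. 1. $V^e_n\otimes V^e_n$ is invariant under $\mathcal R^e_{1/2n,\kappa/2n}(\lambda)$ for every $\lambda\in\mathbb C\setminus\Lambda_\tau$. 2. For every $\lambda\in\mathbb C\setminus\Lambda_\tau$, $\mathcal R^e_{1/2n,\kappa/2n}(\lambda)(\psi_i\otimes\psi_j)=\sum_{k,l\in\mathbb Z/n}R(\lambda)_{ij}^{kl}\,\psi_k\otimes\psi_l$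 with $$R(\lambda)_{ij}^{kl}=\delta_{i+j,\,k+l\ (\mathrm{mod}\ n)}\;\frac{\theta'_{\frac12,\frac12}(0,n\tau)\;\theta_{\frac{i-j}n+\frac12,\frac12}(\lambda-\kappa,n\tau)}{\theta_{\frac{i-k}n+\frac12,\frac12}(-\kappa,n\tau)\;\theta_{\frac{k-j}n+\frac12,\frac12}(\lambda,n\tau)},$$ where any integer representatives of $i,j,k,l$ may be used. 3. The restriction is equivalent to a Belavin $R$-matrix: there is $A\in GL_n(\mathbb C)$, independent of $\lambda$, such that for every $\lambda\in\mathbb C\setminus\Lambda_\tau$ the matrix $R(\lambda)$ of the restriction in the basis $\{\psi_a\otimes\psi_b\}$ satisfies $$R(\lambda)=\frac{\theta'(0)}{\theta(\lambda)}\,(A\otimes A)\,R_B(\lambda)\,(A\otimes A)^{-1}.$$ Here $R_B$ is Belavin's $R$-matrix with parameter $\eta=-\kappa/n$, $$R_B(\lambda)=\sum_{\alpha\in(\mathbb Z/n)^2}w_\alpha(\lambda)\,I_\alpha\otimes I_\alpha^{-1},\qquad w_\alpha(\lambda)=\frac{\theta_{\frac12+\frac{\alpha_2}n,\frac12-\frac{\alpha_1}n}(\lambda+\eta,\tau)}{n\,\theta_{\frac12+\frac{\alpha_2}n,\frac12-\frac{\alpha_1}n}(\eta,\tau)},$$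 with $I_\alpha=S^{\alpha_1}T^{\alpha_2}$, $Se_a=e^{2\pi i a/n}e_a$ and $Te_a=e_{a-1}$ on $\mathbb C^n=\bigoplus_{a\in\mathbb Z/n}\mathbb Ce_a$. -/

import Mathlib

open scoped Real UpperHalfPlane Kronecker
open Complex

namespace ShibukawaUeno

noncomputable section

/-! ### Holomorphic and meromorphic functions -/

/-- The algebra of (everywhere) holomorphic functions on a complex normed space `E`;
it is used for `E = ℂ` and `E = ℂ × ℂ`. -/
def Holo (E : Type) [NormedAddCommGroup E] [NormedSpace ℂ E] : Subalgebra ℂ (E → ℂ) where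
  carrier := {f | Differentiable ℂ f}
  mul_mem' hf hg := Differentiable.mul hf hg
  add_mem' hf hg := Differentiable.add hf hg
  algebraMap_mem' c := differentiable_const c

section

variable {E : Type} [NormedAddCommGroup E] [NormedSpace ℂ E]

/-- Holomorphic functions on `E` form an integral domain (restrict to a complex line). -/
instance Holo.instIsDomain : IsDomain (Holo E) := by
  have : NoZeroDivisors (Holo E) := by
    refine ⟨?_⟩
    rintro ⟨f, hf⟩ ⟨g, hg⟩ hfg
    have hfg' : ∀ x, f x * g x = 0 := fun x => congrFun (congrArg Subtype.val hfg) x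
    by_contra! hne
    obtain ⟨hf0, hg0⟩ := hne
    obtain ⟨p, hp⟩ : ∃ p, f p ≠ 0 := by
      by_contra! h
      exact hf0 (Subtype.ext (funext h))
    obtain ⟨q, hq⟩ : ∃ q, g q ≠ 0 := by
      by_contra! h
      exact hg0 (Subtype.ext (funext h))
    have hline : Differentiable ℂ (fun t : ℂ => p + t • (q - p)) := by fun_prop
    have hfl : Differentiable ℂ (fun t : ℂ => f (p + t • (q - p))) :=
      Differentiable.comp (g := f) hf hline
    have hgl : Differentiable ℂ (fun t : ℂ => g (p + t • (q - p))) :=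
      Differentiable.comp (g := g) hg hline
    have hfa : AnalyticOnNhd ℂ (fun t : ℂ => f (p + t • (q - p))) Set.univ :=
      fun t _ => hfl.analyticAt t
    have hga : AnalyticOnNhd ℂ (fun t : ℂ => g (p + t • (q - p))) Set.univ :=
      fun t _ => hgl.analyticAt t
    rcases AnalyticOnNhd.eq_zero_or_eq_zero_of_mul_eq_zero hfa hga
      (fun t _ => hfg' _) isPreconnected_univ with h | h
    · exact hp (by simpa using h 0 (Set.mem_univ _))
    · exact hq (by simpa using h 1 (Set.mem_univ _))
  exact NoZeroDivisors.to_isDomain _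

end

/-- The field of meromorphic functions on `E = ℂⁿ`: every meromorphic function on `ℂⁿ` is a
quotient of two holomorphic ones (Poincaré, Cousin), so this is the quotient field of the
domain of holomorphic functions. -/
abbrev Mero (E : Type) [NormedAddCommGroup E] [NormedSpace ℂ E] : Type := FractionRing (Holo E)

/-- A biholomorphic automorphism of `E`. -/
structure Biholo (E : Type) [NormedAddCommGroup E] [NormedSpace ℂ E] extends E ≃ E where
  differentiable_toFun : Differentiable ℂ toFun
  differentiable_invFun : Differentiable ℂ invFun

section

variable {E : Type} [NormedAddCommGroup E] [NormedSpace ℂ E]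

/-- The automorphism `f ↦ f ∘ φ` of the algebra of holomorphic functions. -/
def Biholo.compHolo (φ : Biholo E) : Holo E ≃ₐ[ℂ] Holo E where
  toFun f := ⟨fun z => f.1 (φ.toFun z), f.2.comp φ.differentiable_toFun⟩
  invFun f := ⟨fun z => f.1 (φ.invFun z), f.2.comp φ.differentiable_invFun⟩
  left_inv f := Subtype.ext (funext fun z => congrArg f.1 (φ.right_inv z))
  right_inv f := Subtype.ext (funext fun z => congrArg f.1 (φ.left_inv z))
  map_mul' _ _ := rfl
  map_add' _ _ := rfl
  commutes' _ := rfl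

/-- The operator `φ^*`, `f ↦ f ∘ φ`, on meromorphic functions. -/
def Biholo.pullback (φ : Biholo E) : Module.End ℂ (Mero E) :=
  (IsFractionRing.fieldEquivOfAlgEquiv ℂ (Mero E) (Mero E) φ.compHolo).toLinearMap

theorem Biholo.pullback_div (φ : Biholo E) (f g : Holo E) :
    φ.pullback (algebraMap (Holo E) (Mero E) f / algebraMap (Holo E) (Mero E) g) =
      algebraMap (Holo E) (Mero E) (φ.compHolo f) /
        algebraMap (Holo E) (Mero E) (φ.compHolo g) := by
  simp [Biholo.pullback]

end

/-! ### The twisted Shibukawa-Ueno operators -/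

/-- The flip `(z₁, z₂) ↦ (z₂, z₁)`. -/
def flipMap : Biholo (ℂ × ℂ) where
  toEquiv := Equiv.prodComm ℂ ℂ
  differentiable_toFun := differentiable_snd.prodMk differentiable_fst
  differentiable_invFun := differentiable_snd.prodMk differentiable_fst

/-- The translation `(z₁, z₂) ↦ (z₁ + s, z₂ - s)`. -/
def antiShift (s : ℂ) : Biholo (ℂ × ℂ) where
  toFun z := (z.1 + s, z.2 - s)
  invFun z := (z.1 - s, z.2 + s)
  left_inv z := by simp
  right_inv z := by simp
  differentiable_toFun := by fun_prop
  differentiable_invFun := by fun_prop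

/-- The operator `P`: `(P f)(z₁, z₂) = f (z₂, z₁)`. -/
def opP : Module.End ℂ (Mero (ℂ × ℂ)) := flipMap.pullback

/-- The operator `(f ↦ f (z₁ + s, z₂ - s))`. -/
def opShift (s : ℂ) : Module.End ℂ (Mero (ℂ × ℂ)) := (antiShift s).pullback

/-- The holomorphic function `θ (z₁ - z₂ + c)` on `ℂ × ℂ`. -/
def diffArg (θ : Holo ℂ) (c : ℂ) : Holo (ℂ × ℂ) :=
  ⟨fun z => θ.1 (z.1 - z.2 + c),
    Differentiable.comp (g := θ.1) θ.2 (f := fun z : ℂ × ℂ => z.1 - z.2 + c) (by fun_prop)⟩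

/-- The meromorphic function
`G_θ(z₁ - z₂, μ) = θ'(0) θ(z₁ - z₂ + μ) / (θ(z₁ - z₂) θ(μ))` on `ℂ × ℂ`. -/
def kernelG (θ : Holo ℂ) (μ : ℂ) : Mero (ℂ × ℂ) :=
  algebraMap (Holo (ℂ × ℂ)) (Mero (ℂ × ℂ)) (deriv θ.1 0 • diffArg θ μ) /
    algebraMap (Holo (ℂ × ℂ)) (Mero (ℂ × ℂ)) (θ.1 μ • diffArg θ 0)

/-- The Shibukawa-Ueno operator
`R^θ(lam) = G_θ(z₁ - z₂, lam) P - G_θ(z₁ - z₂, κ) I`. -/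
def suOperator (θ : Holo ℂ) (κ lam : ℂ) : Module.End ℂ (Mero (ℂ × ℂ)) :=
  LinearMap.mulLeft ℂ (kernelG θ lam) * opP - LinearMap.mulLeft ℂ (kernelG θ κ)

/-- The twist `F_{α,β}(lam) = φ^*(α lam - β) ⊗ φ^*(α lam - β)⁻¹`, where
`(φ^*(μ) f)(z) = f (z + μ)`. -/
def twist (α β lam : ℂ) : Module.End ℂ (Mero (ℂ × ℂ)) := opShift (α * lam - β)

/-- The twisted Shibukawa-Ueno operator
`R^θ_{α,β}(lam) = F_{α,β}(-lam) R^θ(lam) F_{α,β}(lam)`. -/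
def twistedOperator (θ : Holo ℂ) (κ α β lam : ℂ) : Module.End ℂ (Mero (ℂ × ℂ)) :=
  twist α β (-lam) * suOperator θ κ lam * twist α β lam

/-! ### Theta functions -/

/-- Jacobi's first theta function. -/
def theta1 (z τ : ℂ) : ℂ :=
  -∑' m : ℤ, exp (π * I * ((m : ℂ) + 1 / 2) ^ 2 * τ + 2 * π * I * ((m : ℂ) + 1 / 2) * (z + 1 / 2))

/-- The theta function `θ_{a,b}` with rational characteristics. -/
def thetaChar (a b : ℚ) (z τ : ℂ) : ℂ :=
  ∑' m : ℤ, exp (π * I * ((m : ℂ) + a) ^ 2 * τ + 2 * π * I * ((m : ℂ) + a) * (z + b))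

/-- `ϑ₁(·, τ)` is entire. -/
theorem differentiable_theta1 (τ : ℍ) : Differentiable ℂ (fun z => theta1 z τ) := by
  have h : (fun z => theta1 z τ) = fun z : ℂ =>
      -(exp (π * I * τ / 4 + π * I * (z + 1 / 2)) * jacobiTheta₂ (z + 1 / 2 + τ / 2) τ) := by
    funext z
    simp only [theta1, jacobiTheta₂, jacobiTheta₂_term]
    rw [← tsum_mul_left]
    congr 1
    refine tsum_congr fun m => ?_
    rw [← Complex.exp_add]
    congr 1
    ring
  rw [h]
  have h2 : Differentiable ℂ (fun z : ℂ => jacobiTheta₂ (z + 1 / 2 + τ / 2) τ) := fun z =>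
    DifferentiableAt.comp (g := fun w => jacobiTheta₂ w τ) z
      (differentiableAt_jacobiTheta₂_fst _ τ.im_pos) (by fun_prop)
  fun_prop

/-- `ϑ₁(·, τ)` as an element of the algebra of entire functions. -/
def holoTheta1 (τ : ℍ) : Holo ℂ := ⟨fun z => theta1 z τ, differentiable_theta1 τ⟩

/-- The elliptic twisted operator `R^e_{1/2n, κ/2n}(lam)`. -/
def ellipticOperator (n : ℕ) (τ : ℍ) (κ lam : ℂ) : Module.End ℂ (Mero (ℂ × ℂ)) :=
  twistedOperator (holoTheta1 τ) κ (1 / (2 * n)) (κ / (2 * n)) lam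

/-- The lattice `ℤ + ℤ τ`. -/
def periodLattice (τ : ℍ) : Set ℂ := {z | ∃ a b : ℤ, z = a + b * τ}

/-- The space `V^e_n` of entire functions `f` with `f (z + 1) = (-1)^(n-1) f z` and
`f (z + τ) = exp (- π i n τ - 2 π i n z) f z`. The exponent `n - 1` is used for `n ≥ 1` only. -/
def thetaSpace (n : ℕ) (τ : ℍ) : Submodule ℂ (Holo ℂ) where
  carrier := {f | (∀ z, f.1 (z + 1) = (-1) ^ (n - 1) * f.1 z) ∧
    ∀ z, f.1 (z + τ) = exp (-π * I * n * τ - 2 * π * I * n * z) * f.1 z}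
  zero_mem' := ⟨fun z => by simp, fun z => by simp⟩
  add_mem' {f g} hf hg :=
    ⟨fun z => by
      change f.1 (z + 1) + g.1 (z + 1) = _ * (f.1 z + g.1 z)
      rw [hf.1, hg.1, mul_add],
    fun z => by
      change f.1 (z + τ) + g.1 (z + τ) = _ * (f.1 z + g.1 z)
      rw [hf.2, hg.2, mul_add]⟩
  smul_mem' c f hf :=
    ⟨fun z => by
      change c * f.1 (z + 1) = _ * (c * f.1 z)
      rw [hf.1, mul_left_comm],
    fun z => by
      change c * f.1 (z + τ) = _ * (c * f.1 z)
      rw [hf.2, mul_left_comm]⟩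

/-- The function `f(z₁) g(z₂)` attached to the pure tensor `f ⊗ g`. -/
def tensorFun (f g : Holo ℂ) : Holo (ℂ × ℂ) :=
  ⟨fun z => f.1 z.1 * g.1 z.2,
    (Differentiable.comp (g := f.1) f.2 differentiable_fst).mul
      (Differentiable.comp (g := g.1) g.2 differentiable_snd)⟩

/-- `V^e_n ⊗ V^e_n`, identified with the span of the functions `f(z₁) g(z₂)`, `f, g ∈ V^e_n`,
inside the meromorphic functions on `ℂ × ℂ`. -/
def thetaTensor (n : ℕ) (τ : ℍ) : Submodule ℂ (Mero (ℂ × ℂ)) :=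
  Submodule.span ℂ {F | ∃ f ∈ thetaSpace n τ, ∃ g ∈ thetaSpace n τ,
    F = algebraMap (Holo (ℂ × ℂ)) (Mero (ℂ × ℂ)) (tensorFun f g)}

/-- `ψ_a(z) = ∑_{m ≡ a mod n} exp (π i (m - (n-1)/2)² τ / n + 2 π i (m - (n-1)/2) z)`. -/
def psi (n : ℕ) (τ : ℍ) (a : ZMod n) (z : ℂ) : ℂ :=
  ∑' m : {m : ℤ // (m : ZMod n) = a},
    exp (π * I * ((m.1 : ℂ) - ((n : ℂ) - 1) / 2) ^ 2 * τ / n +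
      2 * π * I * ((m.1 : ℂ) - ((n : ℂ) - 1) / 2) * z)

/-- The matrix coefficient
`δ_{i+j,k+l} θ'_{1/2,1/2}(0,nτ) θ_{(i-j)/n+1/2,1/2}(lam-κ,nτ) /
  (θ_{(i-k)/n+1/2,1/2}(-κ,nτ) θ_{(k-j)/n+1/2,1/2}(lam,nτ))`,
with `i, j, k, l` replaced by their representatives in `{0, …, n-1}`
(`θ_{a+1,b} = θ_{a,b}`, so the choice does not matter). -/
def ellipticCoeff (n : ℕ) (τ : ℍ) (κ lam : ℂ) (i j k l : ZMod n) : ℂ :=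
  if i + j = k + l then
    deriv (fun z => thetaChar (1 / 2) (1 / 2) z (n * τ)) 0 *
        thetaChar (((i.val : ℚ) - j.val) / n + 1 / 2) (1 / 2) (lam - κ) (n * τ) /
      (thetaChar (((i.val : ℚ) - k.val) / n + 1 / 2) (1 / 2) (-κ) (n * τ) *
        thetaChar (((k.val : ℚ) - j.val) / n + 1 / 2) (1 / 2) lam (n * τ))
  else 0

/-! ### Belavin's `R`-matrix -/

/-- The clock matrix `e_a ↦ ω^a e_a`, `ω = exp (2 π i / n)`. -/
def clockMatrix (n : ℕ) : Matrix (ZMod n) (ZMod n) ℂ :=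
  Matrix.diagonal fun a => exp (2 * π * I / n) ^ a.val

/-- The shift matrix `e_a ↦ e_{a-1}`. -/
def shiftMatrix (n : ℕ) : Matrix (ZMod n) (ZMod n) ℂ :=
  Matrix.of fun r c => if r = c - 1 then 1 else 0

/-- `I_α = S^{α₁} T^{α₂}` for `α ∈ (ℤ/n)²`, with `S` the clock and `T` the shift matrix
(so that `T S = ω S T`). -/
def heisenberg (n : ℕ) [NeZero n] (α : ZMod n × ZMod n) : Matrix (ZMod n) (ZMod n) ℂ :=
  clockMatrix n ^ α.1.val * shiftMatrix n ^ α.2.val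

/-- Belavin's weights
`w_α(lam) = θ_{1/2+α₂/n, 1/2-α₁/n}(lam+η,τ) / (n θ_{1/2+α₂/n, 1/2-α₁/n}(η,τ))`. -/
def belavinWeight (n : ℕ) (τ : ℍ) (η lam : ℂ) (α : ZMod n × ZMod n) : ℂ :=
  thetaChar (1 / 2 + (α.2.val : ℚ) / n) (1 / 2 - (α.1.val : ℚ) / n) (lam + η) τ /
    (n * thetaChar (1 / 2 + (α.2.val : ℚ) / n) (1 / 2 - (α.1.val : ℚ) / n) η τ)

/-- Belavin's elliptic `R`-matrix `R_B(lam) = ∑_α w_α(lam) I_α ⊗ I_α⁻¹` with modulus `τ` and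
parameter `η`, on `ℂⁿ ⊗ ℂⁿ`, normalized by `R_B(0) = P`. -/
def belavinR (n : ℕ) [NeZero n] (τ : ℍ) (η lam : ℂ) :
    Matrix (ZMod n × ZMod n) (ZMod n × ZMod n) ℂ :=
  ∑ α : ZMod n × ZMod n, belavinWeight n τ η lam α • (heisenberg n α ⊗ₖ (heisenberg n α)⁻¹)

end

end ShibukawaUeno

/-!
Write `θ` for `theta1`, `e(x) = exp (2πix)` and `Λ = ℤ + ℤτ`. On holomorphic `f` the operator is
`f ↦ G(w, lam) f(z₂ + lam/n, z₁ - lam/n) - G(w, κ) f(z₁ - κ/n, z₂ + κ/n)`, where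
`w = z₁ - z₂ - (lam + κ)/n`. The entries of Belavin's matrix are the discrete Fourier transforms
`belavinEntry` of the weights, entire in `lam`, and everything follows from two identities between
theta functions: on `ψ_i ⊗ ψ_j` the operator acts by the entries of `θ'(0)/θ(lam) • R_B(lam)`
(`kernelDefect_eq_zero`, `ellipticOperator_psiTensor`), and these are the quotients of theta
functions of modulus `nτ` (`residueTheta_quotient_eq_belavinEntry`). In particular the change of
basis between the two matrices can be taken to be the identity.

Both identities are proved by regarding the two sides as functions of `lam` at fixed `z₁, z₂`.
An entire function with constant multipliers along two periods is an exponential, and it vanishes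
unless the multipliers satisfy an integral relation (`eq_exp_of_multipliers`); for the multipliers
at hand the relation would be `κ ∈ Λ`. So it is enough to see that the difference of the two sides
is divisible by a product of theta functions with the same factor of automorphy
(`eq_zero_of_proportional_multipliers`), that is, that it vanishes at the zeros of this product.

* For the operator the product is `θ(lam) θ(w)`. The difference vanishes at `lam = 0`, where `R_B`
  is the flip, and at `w = 0`, where the residues of the two terms cancel. The simultaneous shifts
  `(z₁ + 1/n, lam + 1)`, `(z₁ + τ/n, lam + τ)` permute the indices and carry the first vanishing to
  all of `Λ`; the shifts of `z₁` by `1` and `τ` do the same for the second.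
* For the coefficients of modulus `nτ` the product is `θ(lam)`, and the shift by `τ` permutes the
  family over `ℤ/n` cyclically (`eq_zero_of_theta_family`), so that it suffices to compare the
  values at `lam = 0`. The case `n = 1` of this uniqueness statement gives the dimension one of
  the spaces of theta functions of degree one, hence the basis `ψ_a` of `V^e_n`, after projecting
  to the eigenspaces of the translation by `1/n` (`exists_eq_sum_psi`).

The arguments need that the zeros of `θ` are simple and are exactly the points of `Λ`. For this
`θ` is multiplied by the Appell series `∑ₙ (-1)ⁿ e(n(n+1)τ/2) / (1 - e(z + nτ))`, whose poles are
the points of `Λ`: the product is entire with constant multipliers, hence an exponential, and it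
is not zero because near `z = 0` a single term of the series dominates (`appell_sum_ne_zero`).
-/

namespace ShibukawaUeno

noncomputable section

/-! ### The exponential `e(x) = exp (2πix)` -/

/-- The normalized exponential `e(x) = exp (2πix)`. -/
def e (x : ℂ) : ℂ := exp (2 * π * I * x)

theorem e_add (x y : ℂ) : e (x + y) = e x * e y := by
  rw [e, mul_add, exp_add]; rfl

theorem e_zero : e 0 = 1 := by simp [e]

theorem e_ne_zero (x : ℂ) : e x ≠ 0 := exp_ne_zero _

theorem e_eq_one_iff {x : ℂ} : e x = 1 ↔ ∃ n : ℤ, x = n := by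
  rw [e, exp_eq_one_iff]
  refine exists_congr fun n => ?_
  have h : (2 * π * I : ℂ) ≠ 0 := two_pi_I_ne_zero
  rw [mul_comm (n : ℂ)]
  exact mul_right_inj' h

theorem e_int (n : ℤ) : e n = 1 := e_eq_one_iff.2 ⟨n, rfl⟩

theorem e_one : e 1 = 1 := by exact_mod_cast e_int 1

theorem e_half : e (1 / 2) = -1 := by
  rw [e, ← exp_pi_mul_I]; congr 1; ring

theorem e_neg_half : e (-(1 / 2)) = -1 := by
  have h1 : (-(1 / 2) : ℂ) = 1 / 2 + (-1 : ℤ) := by push_cast; ring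
  rw [h1, e_add, e_int, e_half, mul_one]

theorem e_nat_mul (n : ℕ) (x : ℂ) : e (n * x) = e x ^ n := by
  rw [e, e, ← exp_nat_mul]; congr 1; ring

theorem norm_e (x : ℂ) : ‖e x‖ = Real.exp (-(2 * π * x.im)) := by
  rw [e, norm_exp]; congr 1; simp

theorem differentiable_e : Differentiable ℂ e := by
  unfold e; fun_prop

-- `fun_prop` applies the composed form only
@[fun_prop]
theorem differentiable_e_comp {f : ℂ → ℂ} (hf : Differentiable ℂ f) :
    Differentiable ℂ fun z => e (f z) := differentiable_e.comp hf

/-! ### Quotients of entire functions and Liouville's theorem with multipliers -/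

/-- An entire function vanishing on the zeros of `g`, all of which are simple, is divisible
by `g`. -/
theorem exists_entire_quotient {f g : ℂ → ℂ} (hf : Differentiable ℂ f) (hg : Differentiable ℂ g)
    (h0 : ∀ z, g z = 0 → f z = 0) (h1 : ∀ z, g z = 0 → deriv g z ≠ 0) :
    ∃ h : ℂ → ℂ, Differentiable ℂ h ∧ ∀ z, f z = g z * h z := by
  refine ⟨fun z => if g z = 0 then deriv f z / deriv g z else f z / g z, fun a => ?_,
    fun z => ?_⟩
  · by_cases ha : g a = 0
    · have hfa := h0 a ha
      have hdf : DifferentiableAt ℂ (dslope f a) a :=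
        ((differentiableOn_dslope (s := Set.univ) Filter.univ_mem).2
          hf.differentiableOn).differentiableAt Filter.univ_mem
      have hdg : DifferentiableAt ℂ (dslope g a) a :=
        ((differentiableOn_dslope (s := Set.univ) Filter.univ_mem).2
          hg.differentiableOn).differentiableAt Filter.univ_mem
      have hne : dslope g a a ≠ 0 := by rw [dslope_same]; exact h1 a ha
      refine (hdf.div hdg hne).congr_of_eventuallyEq ?_
      filter_upwards [hdg.continuousAt.eventually_ne hne] with z hz
      by_cases hza : z = a
      · subst hza
        simp [ha, dslope_same]
      · have e1 : (z - a) * dslope f a z = f z := by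
          simpa [hfa] using sub_smul_dslope f a z
        have e2 : (z - a) * dslope g a z = g z := by
          simpa [ha] using sub_smul_dslope g a z
        have hza' : z - a ≠ 0 := sub_ne_zero.2 hza
        have hgz : g z ≠ 0 := by rw [← e2]; exact mul_ne_zero hza' hz
        rw [if_neg hgz, Pi.div_apply, ← e1, ← e2, mul_div_mul_left _ _ hza']
    · have hn := hg.continuous.continuousAt.eventually_ne ha
      refine ((hf a).div (hg a) ha).congr_of_eventuallyEq ?_
      filter_upwards [hn] with z hz
      simp [hz]
  · by_cases hz : g z = 0
    · simp [hz, h0 z hz]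
    · simp only [if_neg hz]
      field_simp

theorem eq_zero_of_mul_eq_zero_entire {f g : ℂ → ℂ} (hf : Differentiable ℂ f)
    (hg : Differentiable ℂ g) (hne : ∃ z, g z ≠ 0) (h : ∀ z, g z * f z = 0) (z : ℂ) :
    f z = 0 := by
  have hfg : (⟨g, hg⟩ : Holo ℂ) * ⟨f, hf⟩ = 0 := Subtype.ext (funext h)
  rcases mul_eq_zero.1 hfg with h' | h'
  · obtain ⟨w, hw⟩ := hne
    exact absurd (congrFun (congrArg Subtype.val h') w) hw
  · exact congrFun (congrArg Subtype.val h') z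

theorem eq_of_mul_eq_mul_entire {f₁ f₂ g : ℂ → ℂ} (hf₁ : Differentiable ℂ f₁)
    (hf₂ : Differentiable ℂ f₂) (hg : Differentiable ℂ g) (hne : ∃ z, g z ≠ 0)
    (h : ∀ z, g z * f₁ z = g z * f₂ z) (z : ℂ) : f₁ z = f₂ z :=
  sub_eq_zero.1 (eq_zero_of_mul_eq_zero_entire (f := fun z => f₁ z - f₂ z) (hf₁.sub hf₂) hg hne
    (fun z => by rw [mul_sub, h, sub_self]) z)

theorem eq_const_of_norm_periodic {σ : ℂ} (hσ : 0 < σ.im) {f : ℂ → ℂ} (hf : Differentiable ℂ f)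
    (h1 : ∀ z, ‖f (z + 1)‖ = ‖f z‖) (h2 : ∀ z, ‖f (z + σ)‖ = ‖f z‖) (z : ℂ) : f z = f 0 := by
  have p1 : Function.Periodic (fun z => ‖f z‖) 1 := h1
  have p2 : Function.Periodic (fun z => ‖f z‖) σ := h2
  refine hf.apply_eq_apply_of_bounded ?_ z 0
  have hK : IsCompact ((fun p : ℝ × ℝ => (p.1 : ℂ) + p.2 * σ) ''
      (Set.Icc 0 1 ×ˢ Set.Icc 0 1)) :=
    (isCompact_Icc.prod isCompact_Icc).image (by fun_prop)
  obtain ⟨C, hC⟩ := hK.exists_bound_of_continuousOn hf.continuous.continuousOn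
  rw [isBounded_iff_forall_norm_le]
  refine ⟨C, ?_⟩
  rintro _ ⟨z, rfl⟩
  set y : ℝ := z.im / σ.im
  set x : ℝ := z.re - y * σ.re
  have hz : z = x + y * σ := by
    apply Complex.ext
    · simp [x]
    · simp [y, hσ.ne']
  have hz' : z = ((Int.fract x : ℝ) + (Int.fract y : ℝ) * σ) + (⌊x⌋ : ℤ) * 1 + (⌊y⌋ : ℤ) * σ := by
    have hx : (x : ℂ) = (⌊x⌋ : ℤ) + (Int.fract x : ℝ) := by
      exact_mod_cast (Int.floor_add_fract x).symm
    have hy : (y : ℂ) = (⌊y⌋ : ℤ) + (Int.fract y : ℝ) := by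
      exact_mod_cast (Int.floor_add_fract y).symm
    linear_combination hz + hx + σ * hy
  have e1 := p2.int_mul ⌊y⌋ (((Int.fract x : ℝ) + (Int.fract y : ℝ) * σ) + (⌊x⌋ : ℤ) * 1)
  have e2 := p1.int_mul ⌊x⌋ ((Int.fract x : ℝ) + (Int.fract y : ℝ) * σ)
  rw [hz']
  refine (e1.trans e2).trans_le ?_
  exact hC _ ⟨(Int.fract x, Int.fract y), ⟨⟨Int.fract_nonneg _, (Int.fract_lt_one _).le⟩,
    ⟨Int.fract_nonneg _, (Int.fract_lt_one _).le⟩⟩, rfl⟩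

/-- Liouville's theorem with multipliers: an entire function with constant multipliers `e(p)`,
`e(q)` along the periods `1`, `σ` is an exponential, and if it is nonzero the multipliers
satisfy a relation. -/
theorem eq_exp_of_multipliers {σ p q : ℂ} (hσ : 0 < σ.im) {f : ℂ → ℂ} (hf : Differentiable ℂ f)
    (h1 : ∀ z, f (z + 1) = e p * f z) (h2 : ∀ z, f (z + σ) = e q * f z) :
    ∃ (C : ℂ) (N M : ℤ), (∀ z, f z = C * e ((p + N) * z)) ∧
      (C = 0 ∨ (p + N) * σ = q + M) := by
  -- the exponential `e(s z)` has multipliers of the same absolute value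
  set s : ℂ := ⟨(q.im - p.im * σ.re) / σ.im, p.im⟩
  have hs1 : (p - s).im = 0 := by simp [s]
  have hs2 : (q - s * σ).im = 0 := by simp [s, hσ.ne']
  set g : ℂ → ℂ := fun z => e (-s * z) * f z
  have hg : Differentiable ℂ g := by fun_prop
  have g1 : ∀ z, g (z + 1) = e (p - s) * g z := fun z => by
    simp only [g, h1]
    rw [← mul_assoc, ← mul_assoc, ← e_add, ← e_add]
    congr 2; ring
  have g2 : ∀ z, g (z + σ) = e (q - s * σ) * g z := fun z => by
    simp only [g, h2]
    rw [← mul_assoc, ← mul_assoc, ← e_add, ← e_add]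
    congr 2; ring
  have hconst := eq_const_of_norm_periodic hσ hg
    (fun z => by rw [g1, norm_mul, norm_e, hs1]; simp)
    (fun z => by rw [g2, norm_mul, norm_e, hs2]; simp)
  have hfg : ∀ z, f z = g 0 * e (s * z) := fun z => by
    rw [← hconst z]
    simp only [g]
    rw [mul_right_comm, ← e_add]
    simp [e_zero]
  by_cases h0 : g 0 = 0
  · exact ⟨0, 0, 0, fun z => by rw [hfg, h0]; simp, Or.inl rfl⟩
  · have k1 : e (p - s) = 1 := by
      have := g1 0
      rw [hconst] at this
      exact (mul_right_cancel₀ h0 (by rw [← this, one_mul]))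
    have k2 : e (q - s * σ) = 1 := by
      have := g2 0
      rw [hconst] at this
      exact (mul_right_cancel₀ h0 (by rw [← this, one_mul]))
    obtain ⟨N, hN⟩ := e_eq_one_iff.1 k1
    obtain ⟨M, hM⟩ := e_eq_one_iff.1 k2
    have hs : p + (-N : ℤ) = s := by push_cast; rw [← hN]; ring
    refine ⟨g 0, -N, -M, fun z => by rw [hs, hfg], Or.inr ?_⟩
    rw [hs]; push_cast; rw [← hM]; ring

/-- Two entire functions with proportional multipliers, the zeros of the second one being simple
and shared by the first one: the first one vanishes unless the multipliers satisfy a relation. -/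
theorem eq_zero_of_proportional_multipliers {σ p q : ℂ} (hσ : 0 < σ.im)
    (hpq : ∀ N M : ℤ, (p + N) * σ ≠ q + M) {f g : ℂ → ℂ}
    (hf : Differentiable ℂ f) (hg : Differentiable ℂ g) (hne : ∃ z, g z ≠ 0)
    (h0 : ∀ z, g z = 0 → f z = 0) (hs : ∀ z, g z = 0 → deriv g z ≠ 0)
    (h1 : ∀ z, f (z + 1) * g z = e p * (g (z + 1) * f z))
    (h2 : ∀ z, f (z + σ) * g z = e q * (g (z + σ) * f z)) (z : ℂ) : f z = 0 := by
  obtain ⟨h, hh, hfg⟩ := exists_entire_quotient hf hg h0 hs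
  have key : ∀ (c a : ℂ), (∀ z, f (z + c) * g z = e a * (g (z + c) * f z)) →
      ∀ z, h (z + c) = e a * h z := by
    intro c a hc z
    refine sub_eq_zero.1 (eq_zero_of_mul_eq_zero_entire
      (f := fun z => h (z + c) - e a * h z) (g := fun z => g z * g (z + c))
      (by fun_prop) (by fun_prop) ?_ (fun z => ?_) z)
    · by_contra! hcon
      obtain ⟨w, hw⟩ := hne
      have hz := eq_zero_of_mul_eq_zero_entire (f := fun z => g (z + c))
        (by fun_prop) hg ⟨w, hw⟩ hcon (w - c)
      simp only [sub_add_cancel] at hz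
      exact hw hz
    · have := hc z
      rw [hfg, hfg] at this
      linear_combination this
  obtain ⟨C, N, M, hC, hC' | hC'⟩ := eq_exp_of_multipliers hσ hh (key 1 p h1) (key σ q h2)
  · rw [hfg, hC, hC']; simp
  · exact absurd hC' (hpq N M)

/-- A set of complex numbers containing `0` and stable under `±1` and `±σ` contains the
lattice `ℤ + ℤσ`. -/
theorem lattice_induction {σ : ℂ} {P : ℂ → Prop} (h0 : P 0) (h1 : ∀ z, P (z + 1) ↔ P z)
    (h2 : ∀ z, P (z + σ) ↔ P z) (a b : ℤ) : P (a + b * σ) := by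
  have p1 : Function.Periodic P 1 := fun z => propext (h1 z)
  have p2 : Function.Periodic P σ := fun z => propext (h2 z)
  have e1 := p2.int_mul b (a : ℂ)
  have e2 := p1.int_mul a 0
  rw [e1]
  simp only [mul_one, zero_add] at e2
  rwa [e2]

/-! ### Quasi-periodicity and zeros of the theta function -/

theorem theta1_eq (z σ : ℂ) :
    theta1 z σ = -(e (σ / 8 + (z + 1 / 2) / 2) * jacobiTheta₂ (z + 1 / 2 + σ / 2) σ) := by
  simp only [theta1, jacobiTheta₂, jacobiTheta₂_term, e]
  rw [← tsum_mul_left]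
  congr 1
  refine tsum_congr fun m => ?_
  rw [← Complex.exp_add]
  congr 1
  ring

theorem differentiable_theta1_of_im_pos {σ : ℂ} (hσ : 0 < σ.im) :
    Differentiable ℂ (fun z => theta1 z σ) := differentiable_theta1 ⟨σ, hσ⟩

theorem theta1_add_one (z σ : ℂ) : theta1 (z + 1) σ = -theta1 z σ := by
  have h : z + 1 + 1 / 2 + σ / 2 = z + 1 / 2 + σ / 2 + 1 := by ring
  have h2 : σ / 8 + (z + 1 + 1 / 2) / 2 = 1 / 2 + (σ / 8 + (z + 1 / 2) / 2) := by ring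
  rw [theta1_eq, theta1_eq, h, jacobiTheta₂_add_left, h2, e_add, e_half]
  ring

theorem theta1_add_tau (z σ : ℂ) : theta1 (z + σ) σ = -e (-σ / 2 - z) * theta1 z σ := by
  have h : z + σ + 1 / 2 + σ / 2 = z + 1 / 2 + σ / 2 + σ := by ring
  have h2 : cexp (-π * I * (σ + 2 * (z + 1 / 2 + σ / 2))) = e (-(σ + (z + 1 / 2))) := by
    rw [e]; congr 1; ring
  have h3 : -e (-σ / 2 - z) = e (1 / 2 + (-σ / 2 - z)) := by rw [e_add, e_half]; ring
  have h4 : e (1 / 2 + (-σ / 2 - z)) = e (-1 + (1 / 2 + (-σ / 2 - z))) := by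
    rw [e_add (-1)]
    have := e_int (-1)
    push_cast at this
    rw [this, one_mul]
  rw [theta1_eq, theta1_eq, h, jacobiTheta₂_add_left', h2, h3, h4]
  rw [mul_neg, ← mul_assoc, ← mul_assoc, ← e_add, ← e_add]
  congr 3; ring

theorem theta1_neg (z σ : ℂ) : theta1 (-z) σ = -theta1 z σ := by
  have h : -z + 1 / 2 + σ / 2 = -(z - 1 / 2 - σ / 2) := by ring
  have h2 : z + 1 / 2 + σ / 2 = z - 1 / 2 - σ / 2 + σ + 1 := by ring
  have h3 : cexp (-π * I * (σ + 2 * (z - 1 / 2 - σ / 2))) = e (-(z - 1 / 2)) := by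
    rw [e]; congr 1; ring
  rw [theta1_eq, theta1_eq, h, jacobiTheta₂_neg_left, h2, jacobiTheta₂_add_left,
    jacobiTheta₂_add_left', h3, ← mul_assoc, ← e_add, neg_neg, ← neg_mul,
    ← neg_one_mul (e _), ← e_half, ← e_add]
  congr 2; ring

theorem theta1_zero (σ : ℂ) : theta1 0 σ = 0 := by
  have h := theta1_neg 0 σ
  rw [neg_zero] at h
  exact self_eq_neg.1 h

theorem theta1_sub_one (z σ : ℂ) : theta1 (z - 1) σ = -theta1 z σ := by
  have h := theta1_add_one (z - 1) σ
  rw [sub_add_cancel] at h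
  rw [h, neg_neg]

theorem theta1_lattice (σ : ℂ) (a b : ℤ) : theta1 (a + b * σ) σ = 0 :=
  lattice_induction (P := fun z => theta1 z σ = 0) (theta1_zero σ)
    (fun z => by rw [theta1_add_one, neg_eq_zero])
    (fun z => by rw [theta1_add_tau]; simp [e_ne_zero]) a b

/-- The theta function is not identically zero: a Fourier coefficient of the Jacobi theta
function is `1`. -/
theorem exists_jacobiTheta₂_ne_zero {σ : ℂ} (hσ : 0 < σ.im) : ∃ z, jacobiTheta₂ z σ ≠ 0 := by
  by_contra! h
  have hs := intervalIntegral.hasSum_integral_of_dominated_convergence (a := 0) (b := 1)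
    (μ := MeasureTheory.volume)
    (F := fun (n : ℤ) (t : ℝ) => jacobiTheta₂_term n t σ)
    (f := fun t : ℝ => jacobiTheta₂ t σ)
    (fun n _ => ‖jacobiTheta₂_term n 0 σ‖)
    (fun n => by
      refine Continuous.aestronglyMeasurable ?_
      unfold jacobiTheta₂_term; fun_prop)
    (fun n => Filter.Eventually.of_forall fun t _ => by
      simp [norm_jacobiTheta₂_term])
    (Filter.Eventually.of_forall fun t _ => ((summable_jacobiTheta₂_term_iff 0 σ).2 hσ).norm)
    intervalIntegrable_const
    (Filter.Eventually.of_forall fun t _ => hasSum_jacobiTheta₂_term t hσ)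
  have h0 : (∫ t : ℝ in (0 : ℝ)..1, jacobiTheta₂ t σ) = 0 := by simp [h]
  rw [h0] at hs
  have hone : HasSum (fun n : ℤ => ∫ t : ℝ in (0 : ℝ)..1, jacobiTheta₂_term n t σ) 1 := by
    convert hasSum_ite_eq (0 : ℤ) (1 : ℂ) using 2 with n
    split_ifs with hn
    · simp [jacobiTheta₂_term, hn]
    · have hc : (2 * π * I * n : ℂ) ≠ 0 := by
        simp [hn, Real.pi_ne_zero]
      simp only [jacobiTheta₂_term, Complex.exp_add]
      rw [intervalIntegral.integral_mul_const, integral_exp_mul_complex hc]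
      have : cexp (2 * π * I * n * (1 : ℝ)) = 1 := by
        rw [exp_eq_one_iff]; exact ⟨n, by push_cast; ring⟩
      rw [this]; simp
  exact zero_ne_one (hs.unique hone)

theorem exists_theta1_ne_zero {σ : ℂ} (hσ : 0 < σ.im) : ∃ z, theta1 z σ ≠ 0 := by
  obtain ⟨z, hz⟩ := exists_jacobiTheta₂_ne_zero hσ
  refine ⟨z - 1 / 2 - σ / 2, ?_⟩
  rw [theta1_eq]
  have : z - 1 / 2 - σ / 2 + 1 / 2 + σ / 2 = z := by ring
  rw [this]
  exact neg_ne_zero.2 (mul_ne_zero (e_ne_zero _) hz)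

theorem le_norm_one_sub_e {t : ℝ} {w : ℂ} (hw : t ≤ |w.im|) :
    1 - Real.exp (-(2 * π * t)) ≤ ‖1 - e w‖ := by
  have hpi := Real.pi_pos
  rcases le_abs.1 hw with h | h
  · have h1 : ‖e w‖ ≤ Real.exp (-(2 * π * t)) := by
      rw [norm_e]; gcongr
    have h2 := norm_sub_norm_le 1 (e w)
    rw [norm_one] at h2
    linarith
  · have h1 : Real.exp (2 * π * t) ≤ ‖e w‖ := by
      rw [norm_e]; apply Real.exp_le_exp.2; nlinarith
    have h2 := norm_sub_norm_le (e w) 1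
    rw [norm_one, norm_sub_rev] at h2
    have h3 := Real.add_one_le_exp (2 * π * t)
    have h4 := Real.add_one_le_exp (-(2 * π * t))
    linarith

/-- The factors `1 - e(z + nσ)` are uniformly bounded below on a strip, up to finitely many. -/
theorem exists_finset_half_le_norm {σ : ℂ} (hσ : 0 < σ.im) (R : ℝ) :
    ∃ S : Finset ℤ, ∀ n ∉ S, ∀ z : ℂ, |z.im| ≤ R → 1 / 2 ≤ ‖1 - e (z + n * σ)‖ := by
  obtain ⟨K, hK⟩ := exists_nat_ge ((R + 1) / σ.im)
  rw [div_le_iff₀ hσ] at hK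
  refine ⟨Finset.Icc (-K) K, fun n hn z hz => ?_⟩
  have h1 : (1 : ℝ) ≤ |(z + n * σ).im| := by
    have him : (z + n * σ).im = z.im + n * σ.im := by simp
    rw [him]
    obtain ⟨hz1, hz2⟩ := abs_le.1 hz
    rw [Finset.mem_Icc, not_and_or, not_le, not_le] at hn
    rcases hn with h | h
    · have h' : (n : ℝ) ≤ -K := by exact_mod_cast h.le
      refine le_abs.2 (Or.inr ?_)
      nlinarith
    · have h' : (K : ℝ) ≤ n := by exact_mod_cast h.le
      refine le_abs.2 (Or.inl ?_)
      nlinarith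
  have h2 := le_norm_one_sub_e h1
  have h3 : Real.exp (-(2 * π * 1)) ≤ 1 / 2 := by
    rw [Real.exp_neg, one_div]
    apply inv_anti₀ two_pos
    have := Real.add_one_le_exp (2 * π * 1)
    linarith [Real.pi_gt_three]
  linarith

theorem one_sub_e_eq_zero_iff {σ z : ℂ} {n : ℤ} :
    1 - e (z + n * σ) = 0 ↔ ∃ m : ℤ, z = m + (-n : ℤ) * σ := by
  rw [sub_eq_zero, eq_comm, e_eq_one_iff]
  refine exists_congr fun m => ?_
  push_cast
  constructor <;> intro h
  · linear_combination h
  · linear_combination h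

theorem hasDerivAt_one_sub_e (c z : ℂ) :
    HasDerivAt (fun z => 1 - e (z + c)) (-(2 * π * I * e (z + c))) z := by
  have h1 : HasDerivAt (fun z : ℂ => 2 * π * I * (z + c)) (2 * π * I) z := by
    simpa using ((hasDerivAt_id z).add_const c).const_mul (2 * π * I : ℂ)
  exact ((h1.cexp).const_sub 1).congr_deriv (by rw [e]; ring)

theorem exists_one_sub_e_ne_zero (c : ℂ) : ∃ z, 1 - e (z + c) ≠ 0 :=
  ⟨1 / 2 - c, by rw [sub_add_cancel, e_half]; norm_num⟩

theorem exists_theta1_quotient {σ : ℂ} (hσ : 0 < σ.im) (n : ℤ) :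
    ∃ h : ℂ → ℂ, Differentiable ℂ h ∧ ∀ z, theta1 z σ = (1 - e (z + n * σ)) * h z :=
  exists_entire_quotient (g := fun z => 1 - e (z + n * σ)) (differentiable_theta1_of_im_pos hσ)
    (by fun_prop)
    (fun z hz => by
      obtain ⟨m, rfl⟩ := one_sub_e_eq_zero_iff.1 hz
      exact theta1_lattice σ m (-n))
    (fun z _ => by
      rw [(hasDerivAt_one_sub_e _ z).deriv]
      exact neg_ne_zero.2 (mul_ne_zero two_pi_I_ne_zero (e_ne_zero _)))

/-- The `n`-th coefficient `(-1)ⁿ e(n(n+1)σ/2)` of the Appell series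
`∑ₙ (-1)ⁿ e(n(n+1)σ/2) / (1 - e(z + nσ))`. -/
def appellCoeff (σ : ℂ) (n : ℤ) : ℂ := jacobiTheta₂_term n (1 / 2 + σ / 2) σ

theorem summable_appellCoeff {σ : ℂ} (hσ : 0 < σ.im) : Summable (appellCoeff σ) :=
  (summable_jacobiTheta₂_term_iff _ σ).2 hσ

/-- The product of the theta function and the Appell series: with entire quotients
`h n = θ / (1 - e(z + nσ))`, the function `∑ₙ (-1)ⁿ e(n(n+1)σ/2) h n` is a nowhere vanishing
exponential. -/
theorem appell_sum_ne_zero {σ : ℂ} (hσ : 0 < σ.im) {h : ℤ → ℂ → ℂ}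
    (hd : ∀ n, Differentiable ℂ (h n))
    (hh : ∀ (n : ℤ) z, theta1 z σ = (1 - e (z + n * σ)) * h n z) (z : ℂ) :
    ∑' n, appellCoeff σ n * h n z ≠ 0 := by
  have hθ := differentiable_theta1_of_im_pos hσ
  set c := appellCoeff σ with hc
  have hcs : Summable c := summable_appellCoeff hσ
  -- all but finitely many terms are bounded by `2 ‖c n‖ ‖θ‖` on a strip
  have hloc : ∀ (R : ℝ), ∃ S : Finset ℤ, ∀ n ∉ S, ∀ z : ℂ, |z.im| ≤ R →
      ‖c n * h n z‖ ≤ ‖c n‖ * (2 * ‖theta1 z σ‖) := by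
    intro R
    obtain ⟨S, hS⟩ := exists_finset_half_le_norm hσ R
    refine ⟨S, fun n hn z hz => ?_⟩
    have h1 := hS n hn z hz
    have h2 := congrArg norm (hh n z)
    rw [norm_mul] at h2 ⊢
    gcongr
    rw [h2]
    nlinarith [norm_nonneg (h n z)]
  have hsum : ∀ z, Summable fun n => c n * h n z := by
    intro z
    obtain ⟨S, hS⟩ := hloc |z.im|
    rw [← S.summable_compl_iff]
    exact Summable.of_norm_bounded
      ((hcs.norm.mul_right (2 * ‖theta1 z σ‖)).subtype {n | n ∉ S})
      (fun n => hS n.1 n.2 z le_rfl)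
  set Φ : ℂ → ℂ := fun z => ∑' n, c n * h n z with hΦ
  have hΦd : Differentiable ℂ Φ := by
    intro a
    obtain ⟨S, hS⟩ := hloc (|a.im| + 1)
    set U : Set ℂ := {z | |z.im| < |a.im| + 1} ∩ {z | ‖theta1 z σ‖ < ‖theta1 a σ‖ + 1}
    have hU : IsOpen U :=
      (isOpen_lt (by fun_prop) continuous_const).inter
        (isOpen_lt hθ.continuous.norm continuous_const)
    have haU : a ∈ U := ⟨lt_add_one |a.im|, lt_add_one ‖theta1 a σ‖⟩
    have hdiff : DifferentiableOn ℂ (fun z => ∑' n : {n // n ∉ S}, c n * h n z) U := by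
      refine differentiableOn_tsum_of_summable_norm
        ((hcs.norm.mul_right (2 * (‖theta1 a σ‖ + 1))).subtype {n | n ∉ S})
        (fun n => ((hd n).const_mul (c n)).differentiableOn) hU ?_
      intro n z hz
      refine (hS n.1 n.2 z hz.1.le).trans ?_
      simp only [Function.comp]
      gcongr
      exact hz.2.le
    have hfin : Differentiable ℂ (fun z => ∑ n ∈ S, c n * h n z) :=
      Differentiable.fun_sum fun n _ => (hd n).const_mul (c n)
    have heq : Φ = fun z => (∑ n ∈ S, c n * h n z) + ∑' n : {n // n ∉ S}, c n * h n z :=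
      funext fun z => ((hsum z).sum_add_tsum_subtype_compl S).symm
    rw [heq]
    exact (hfin a).add (hdiff.differentiableAt (hU.mem_nhds haU))
  -- the quotients inherit their transformation laws from `θ`
  have h_one : ∀ n z, h n (z + 1) = -h n z := fun n =>
    eq_of_mul_eq_mul_entire (g := fun z => 1 - e (z + n * σ)) ((hd n).comp (by fun_prop))
      (hd n).neg (by fun_prop) (exists_one_sub_e_ne_zero _) fun z => by
        have h1 := hh n (z + 1)
        have h2 : e (z + 1 + n * σ) = e (z + n * σ) := by
          rw [add_right_comm, e_add, e_one, mul_one]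
        rw [theta1_add_one, h2, hh n z] at h1
        change _ = _ * -h n z
        linear_combination -h1
  have h_tau : ∀ n z, h n (z + σ) = -e (-σ / 2 - z) * h (n + 1) z := fun n =>
    eq_of_mul_eq_mul_entire (g := fun z => 1 - e (z + (n + 1 : ℤ) * σ))
      ((hd n).comp (by fun_prop))
      (((by fun_prop : Differentiable ℂ fun z => -e (-σ / 2 - z))).mul (hd (n + 1)))
      (by fun_prop) (exists_one_sub_e_ne_zero _) fun z => by
        have h1 := hh n (z + σ)
        have h2 : z + σ + n * σ = z + (n + 1 : ℤ) * σ := by push_cast; ring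
        rw [theta1_add_tau, h2, hh (n + 1) z] at h1
        linear_combination -h1
  have hΦ1 : ∀ z, Φ (z + 1) = e (1 / 2) * Φ z := fun z => by
    simp only [hΦ, h_one, e_half]
    rw [← tsum_mul_left]
    exact tsum_congr fun n => by ring
  -- the constant term of the transformation under `σ` is a value of `θ` at the lattice
  have hconst : ∑' n, c n * e (-n * σ) = 0 := by
    have h1 := theta1_lattice σ 0 (-1)
    rw [theta1_eq, neg_eq_zero, mul_eq_zero, or_iff_right (e_ne_zero _)] at h1
    rw [← h1, jacobiTheta₂]
    refine tsum_congr fun n => ?_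
    rw [hc, appellCoeff, jacobiTheta₂_term, jacobiTheta₂_term, e, ← Complex.exp_add]
    congr 1; push_cast; ring
  have hconst_s : Summable fun n => c n * e (-n * σ) := by
    convert (summable_jacobiTheta₂_term_iff (1 / 2 - σ / 2) σ).2 hσ using 2 with n
    rw [hc, appellCoeff, jacobiTheta₂_term, jacobiTheta₂_term, e, ← Complex.exp_add]
    congr 1; ring
  -- `h n = θ + e(z + nσ) h n` splits the shifted series into a multiple of `θ` and the series
  have hshift : ∀ n z, c n * (-e (-σ / 2 - z) * h (n + 1) z) =
      e (-σ / 2 - z) * (theta1 z σ * (c (n + 1) * e (-(n + 1 : ℤ) * σ)) +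
        e z * (c (n + 1) * h (n + 1) z)) := by
    intro n z
    have h1 : c (n + 1) * e (-(n + 1 : ℤ) * σ) = -c n := by
      have hneg : ∀ x, -cexp x = cexp (π * I + x) := fun x => by
        rw [Complex.exp_add, exp_pi_mul_I, neg_one_mul]
      rw [hc, appellCoeff, appellCoeff, jacobiTheta₂_term, jacobiTheta₂_term, e,
        ← Complex.exp_add, hneg]
      congr 1; push_cast; ring
    have h2 : e (-(n + 1 : ℤ) * σ) * e (z + (n + 1 : ℤ) * σ) = e z := by
      rw [← e_add]; congr 1; ring
    rw [hh (n + 1) z]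
    linear_combination e (-σ / 2 - z) * h (n + 1) z * (-h1 + c (n + 1) * h2)
  have hΦ2 : ∀ z, Φ (z + σ) = e (-σ / 2) * Φ z := fun z => by
    have e1 : ∀ f : ℤ → ℂ, ∑' n, f (n + 1) = ∑' n, f n := fun f =>
      (Equiv.addRight (1 : ℤ)).tsum_eq f
    have e2 : e (-σ / 2 - z) * e z = e (-σ / 2) := by rw [← e_add]; congr 1; ring
    simp only [hΦ, h_tau, hshift]
    rw [e1 (fun n => e (-σ / 2 - z) * (theta1 z σ * (c n * e (-n * σ)) + e z * (c n * h n z))),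
      tsum_mul_left, (hconst_s.mul_left _).tsum_add ((hsum z).mul_left _), tsum_mul_left,
      tsum_mul_left, hconst, ← e2]
    ring
  obtain ⟨C, N, M, hC, -⟩ := eq_exp_of_multipliers hσ hΦd hΦ1 hΦ2
  suffices hC0 : C ≠ 0 by
    change Φ z ≠ 0
    rw [hC]; exact mul_ne_zero hC0 (e_ne_zero _)
  intro hC0
  have hΦ0 : ∀ z, Φ z = 0 := fun z => by rw [hC, hC0, zero_mul]
  -- near `0` all terms but the one with `n = 0` are `O(θ)`, and that one is `θ / (1 - e(z))`
  set η : ℝ := 1 - Real.exp (-(2 * π * (σ.im / 2))) with hη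
  have hη0 : 0 < η := by
    have : Real.exp (-(2 * π * (σ.im / 2))) < 1 := by
      rw [Real.exp_lt_one_iff]; have := Real.pi_pos; nlinarith [mul_pos this hσ]
    linarith
  have hc0 : c 0 = 1 := by simp [hc, appellCoeff, jacobiTheta₂_term]
  have hbound : ∀ z : ℂ, |z.im| < σ.im / 2 → ‖h 0 z‖ ≤
      (∑' n, ‖c n‖) / η * ‖1 - e z‖ * ‖h 0 z‖ := by
    intro z hz
    have hterm : ∀ n : ℤ, ‖if n = 0 then 0 else c n * h n z‖ ≤ ‖c n‖ * (‖theta1 z σ‖ / η) := by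
      intro n
      split_ifs with hn
      · rw [norm_zero]; positivity
      · rw [norm_mul]
        gcongr
        rw [le_div_iff₀ hη0, hh n z, norm_mul, mul_comm]
        gcongr
        apply le_norm_one_sub_e
        have him : (z + n * σ).im = z.im + n * σ.im := by simp
        rw [him]
        obtain ⟨hz1, hz2⟩ := abs_lt.1 hz
        rcases lt_or_gt_of_ne hn with h' | h'
        · have : (n : ℝ) ≤ -1 := by exact_mod_cast (by omega : n ≤ -1)
          refine le_abs.2 (Or.inr ?_)
          nlinarith
        · have : (1 : ℝ) ≤ n := by exact_mod_cast (by omega : 1 ≤ n)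
          refine le_abs.2 (Or.inl ?_)
          nlinarith
    have hsplit := (hsum z).tsum_eq_add_tsum_ite 0
    have h0 : h 0 z = -∑' n : ℤ, if n = 0 then 0 else c n * h n z := by
      have := hΦ0 z
      simp only [hΦ] at this
      rw [this, hc0, one_mul] at hsplit
      linear_combination -hsplit
    calc ‖h 0 z‖ = ‖∑' n : ℤ, if n = 0 then 0 else c n * h n z‖ := by
          conv_lhs => rw [h0, norm_neg]
      _ ≤ ∑' n, ‖c n‖ * (‖theta1 z σ‖ / η) :=
          tsum_of_norm_bounded (hcs.norm.mul_right _).hasSum hterm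
      _ = (∑' n, ‖c n‖) / η * ‖1 - e z‖ * ‖h 0 z‖ := by
          rw [tsum_mul_right, hh 0 z, norm_mul]
          simp only [Int.cast_zero, zero_mul, add_zero]
          ring
  have hev : ∀ᶠ z in nhds (0 : ℂ), theta1 z σ = 0 := by
    have c1 : ∀ᶠ z : ℂ in nhds 0, |z.im| < σ.im / 2 := by
      have : ContinuousAt (fun z : ℂ => |z.im|) 0 := by fun_prop
      exact this.eventually_lt_const (by simpa using hσ)
    have c2 : ∀ᶠ z : ℂ in nhds 0, (∑' n, ‖c n‖) / η * ‖1 - e z‖ < 1 := by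
      have : ContinuousAt (fun z : ℂ => (∑' n, ‖c n‖) / η * ‖1 - e z‖) 0 :=
        (continuous_const.mul
          (continuous_const.sub differentiable_e.continuous).norm).continuousAt
      exact this.eventually_lt_const (by simp [e_zero])
    filter_upwards [c1, c2] with z hz1 hz2
    have h3 := hbound z hz1
    have h4 : ‖h 0 z‖ = 0 := by nlinarith [norm_nonneg (h 0 z)]
    rw [hh 0 z, norm_eq_zero.1 h4, mul_zero]
  obtain ⟨w, hw⟩ := exists_theta1_ne_zero hσ
  have han : AnalyticOnNhd ℂ (fun z => theta1 z σ) Set.univ := fun z _ => hθ.analyticAt z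
  exact hw (han.eqOn_zero_of_preconnected_of_eventuallyEq_zero isPreconnected_univ
    (Set.mem_univ 0) hev (Set.mem_univ w))

/-- At a zero off the lattice every quotient `θ / (1 - e(z + nσ))` would vanish, and with them
the sum of `appell_sum_ne_zero`. -/
theorem theta1_eq_zero_iff {σ : ℂ} (hσ : 0 < σ.im) {z : ℂ} :
    theta1 z σ = 0 ↔ ∃ a b : ℤ, z = a + b * σ := by
  refine ⟨fun hz => ?_, fun ⟨a, b, hab⟩ => hab ▸ theta1_lattice σ a b⟩
  by_contra hcon
  choose h hd hh using exists_theta1_quotient hσ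
  refine appell_sum_ne_zero hσ hd hh z ?_
  convert tsum_zero with n
  have h1 := hh n z
  rw [hz, eq_comm, mul_eq_zero, one_sub_e_eq_zero_iff] at h1
  rcases h1 with ⟨m, hm⟩ | h1
  · exact absurd ⟨m, -n, hm⟩ hcon
  · rw [h1, mul_zero]

/-- At a lattice point only one term of the sum of `appell_sum_ne_zero` survives, and it is a
nonzero multiple of the derivative of `θ`. -/
theorem deriv_theta1_ne_zero {σ : ℂ} (hσ : 0 < σ.im) {z : ℂ} (hz : theta1 z σ = 0) :
    deriv (fun z => theta1 z σ) z ≠ 0 := by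
  obtain ⟨a, b, rfl⟩ := (theta1_eq_zero_iff hσ).1 hz
  choose h hd hh using exists_theta1_quotient hσ
  have key : ∀ n : ℤ, n ≠ -b → h n (a + b * σ) = 0 := by
    intro n hn
    have h1 := hh n (a + b * σ)
    rw [hz, eq_comm, mul_eq_zero, one_sub_e_eq_zero_iff] at h1
    rcases h1 with ⟨m, hm⟩ | h1
    · have him := congrArg Complex.im hm
      simp only [add_im, intCast_im, mul_im, intCast_re, zero_mul, zero_add, add_zero] at him
      have : (b : ℝ) = (-n : ℤ) := mul_right_cancel₀ hσ.ne' him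
      have : b = -n := by exact_mod_cast this
      omega
    · exact h1
  have hne : h (-b) (a + b * σ) ≠ 0 := by
    have := appell_sum_ne_zero hσ hd hh (a + b * σ)
    rw [tsum_eq_single (-b) (fun n hn => by rw [key n hn, mul_zero])] at this
    exact right_ne_zero_of_mul this
  have hfun : (fun z => theta1 z σ) = fun z => (1 - e (z + (-b : ℤ) * σ)) * h (-b) z :=
    funext (hh (-b))
  have h0 : e (a + b * σ + (-b : ℤ) * σ) = 1 :=
    e_eq_one_iff.2 ⟨a, by push_cast; ring⟩
  rw [hfun, ((hasDerivAt_one_sub_e _ _).fun_mul (hd (-b) _).hasDerivAt).deriv, h0]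
  simp [hne, Real.pi_ne_zero]

theorem theta1_add_nat (m : ℕ) (z σ : ℂ) : theta1 (z + m) σ = (-1) ^ m * theta1 z σ := by
  induction m with
  | zero => simp
  | succ m ih =>
    rw [Nat.cast_succ, ← add_assoc, theta1_add_one, ih, pow_succ]; ring

theorem theta1_add_nat_mul (m : ℕ) (z σ : ℂ) :
    theta1 (z + m * σ) σ = (-1) ^ m * e (-m ^ 2 * σ / 2 - m * z) * theta1 z σ := by
  induction m with
  | zero => simp [e_zero]
  | succ m ih =>
    have h : z + (m + 1 : ℕ) * σ = z + m * σ + σ := by push_cast; ring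
    have h2 : e (-(m + 1 : ℕ) ^ 2 * σ / 2 - (m + 1 : ℕ) * z) =
        e (-σ / 2 - (z + m * σ)) * e (-m ^ 2 * σ / 2 - m * z) := by
      rw [← e_add]; congr 1; push_cast; ring
    rw [h, theta1_add_tau, ih, h2, pow_succ]; ring

/-! ### Uniqueness of theta functions -/

/-- A family `D m`, `m ∈ ℤ/n`, of entire functions which the translation by `σ` permutes
cyclically up to the factor of automorphy of `θ` vanishes if it vanishes at `0`, for generic
multipliers: `D m / θ` is entire with constant multipliers along `1` and `nσ`. -/
theorem eq_zero_of_theta_family {n : ℕ} [NeZero n] {σ p q : ℂ} (hσ : 0 < σ.im)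
    (hpq : ∀ N M : ℤ, (p + N) * (n * σ) ≠ n * q + M) {D : ZMod n → ℂ → ℂ}
    (hD : ∀ m, Differentiable ℂ (D m)) (h1 : ∀ m z, D m (z + 1) = -e p * D m z)
    (h2 : ∀ m z, D m (z + σ) = -e (-σ / 2 - z + q) * D (m + 1) z)
    (h0 : ∀ m, D m 0 = 0) (m : ZMod n) (z : ℂ) : D m z = 0 := by
  have hvan : ∀ a b : ℤ, ∀ m, D m (a + b * σ) = 0 := by
    refine lattice_induction (P := fun z => ∀ m, D m z = 0) h0 (fun z => ?_) (fun z => ?_)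
    · simp [h1, e_ne_zero]
    · simp only [h2, mul_eq_zero, neg_eq_zero, e_ne_zero, false_or]
      exact ⟨fun h m => by simpa using h (m - 1), fun h m => h _⟩
  have hiter : ∀ (k : ℕ) (m : ZMod n) (z : ℂ), D m (z + k * σ) =
      (-1) ^ k * e (-k ^ 2 * σ / 2 - k * z + k * q) * D (m + k) z := by
    intro k
    induction k with
    | zero => simp [e_zero]
    | succ k ih =>
      intro m z
      have h : z + (k + 1 : ℕ) * σ = z + k * σ + σ := by push_cast; ring
      have h3 : e (-(k + 1 : ℕ) ^ 2 * σ / 2 - (k + 1 : ℕ) * z + (k + 1 : ℕ) * q) =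
          e (-σ / 2 - (z + k * σ) + q) * e (-k ^ 2 * σ / 2 - k * z + k * q) := by
        rw [← e_add]; congr 1; push_cast; ring
      have h4 : m + 1 + (k : ZMod n) = m + (k + 1 : ℕ) := by push_cast; ring
      rw [h, h2, ih, h3, pow_succ, h4]; ring
  have hn : (0 : ℝ) < n := by exact_mod_cast Nat.pos_of_ne_zero (NeZero.ne n)
  have him : 0 < ((n : ℂ) * σ).im := by simpa using mul_pos hn hσ
  refine eq_zero_of_proportional_multipliers him hpq (hD m) (differentiable_theta1_of_im_pos hσ)
    (exists_theta1_ne_zero hσ) (fun z hz => ?_) (fun z hz => deriv_theta1_ne_zero hσ hz)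
    (fun z => ?_) (fun z => ?_) z
  · obtain ⟨a, b, rfl⟩ := (theta1_eq_zero_iff hσ).1 hz
    exact hvan a b m
  · rw [h1, theta1_add_one]; ring
  · rw [hiter, theta1_add_nat_mul, ZMod.natCast_self, add_zero, e_add _ (n * q)]; ring

/-- Theta functions of degree one with given multipliers form a space of dimension one. -/
theorem exists_eq_const_mul_of_degree_one {σ p q : ℂ} (hσ : 0 < σ.im) {f g : ℂ → ℂ}
    (hf : Differentiable ℂ f) (hg : Differentiable ℂ g) (hne : ∃ z, g z ≠ 0)
    (f1 : ∀ z, f (z + 1) = e p * f z) (g1 : ∀ z, g (z + 1) = e p * g z)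
    (f2 : ∀ z, f (z + σ) = e (-σ / 2 - z + q) * f z)
    (g2 : ∀ z, g (z + σ) = e (-σ / 2 - z + q) * g z) :
    ∃ C : ℂ, ∀ z, f z = C * g z := by
  -- the base point avoids the zeros of `g` and the resonant values of the multipliers
  obtain ⟨w, hw⟩ : ∃ w, theta1 (w - q + 1 / 2 + (p + 1 / 2) * σ) σ * g w ≠ 0 := by
    by_contra! hcon
    obtain ⟨z, hz⟩ := hne
    obtain ⟨y, hy⟩ := exists_theta1_ne_zero hσ
    refine hz (eq_zero_of_mul_eq_zero_entire
      (g := fun w => theta1 (w - q + 1 / 2 + (p + 1 / 2) * σ) σ) hg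
      ((differentiable_theta1_of_im_pos hσ).comp (by fun_prop)) ?_ hcon z)
    refine ⟨y + q - 1 / 2 - (p + 1 / 2) * σ, ?_⟩
    ring_nf at hy ⊢
    exact hy
  have hw2 := right_ne_zero_of_mul hw
  have hw1 := (theta1_eq_zero_iff hσ).not.1 (left_ne_zero_of_mul hw)
  refine ⟨f w / g w, fun z => sub_eq_zero.1 ?_⟩
  have key := eq_zero_of_theta_family (n := 1) (σ := σ) (p := p + 1 / 2) (q := q - w + 1 / 2) hσ
    (fun N M h => hw1 ⟨M + 1, -N, by push_cast at h ⊢; linear_combination h⟩)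
    (D := fun _ z => f (w + z) - f w / g w * g (w + z))
    (fun _ => by fun_prop)
    (fun _ z => by
      rw [← add_assoc, f1, g1, e_add, e_half]; ring)
    (fun _ z => by
      have h : -σ / 2 - z + (q - w + 1 / 2) = (-σ / 2 - (w + z) + q) + 1 / 2 := by ring
      rw [← add_assoc, f2, g2, h, e_add _ (1 / 2), e_half]; ring)
    (fun _ => by
      simp only [add_zero]
      field_simp
      ring) 0 (z - w)
  simpa using key

/-! ### Theta functions with characteristics and the functions `ψ_a` -/

/-- Every theta function with characteristics is an exponential times a translate of `ϑ₁`. -/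
theorem thetaChar_eq (a b : ℚ) (z σ : ℂ) : thetaChar a b z σ =
    -e ((a - 1 / 2) ^ 2 * σ / 2 + (a - 1 / 2) * (z + b)) *
      theta1 (z + (b - 1 / 2) + (a - 1 / 2) * σ) σ := by
  simp only [theta1, thetaChar, e]
  rw [neg_mul_neg, ← tsum_mul_left]
  refine tsum_congr fun m => ?_
  rw [← Complex.exp_add]
  congr 1
  ring

theorem differentiable_thetaChar (a b : ℚ) {σ : ℂ} (hσ : 0 < σ.im) :
    Differentiable ℂ fun z => thetaChar a b z σ := by
  have h : Differentiable ℂ fun z : ℂ => theta1 (z + (b - 1 / 2) + (a - 1 / 2) * σ) σ :=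
    (differentiable_theta1_of_im_pos hσ).comp (by fun_prop)
  simp only [thetaChar_eq]
  fun_prop

theorem thetaChar_eq_zero_iff {a b : ℚ} {z σ : ℂ} (hσ : 0 < σ.im) : thetaChar a b z σ = 0 ↔
    ∃ k l : ℤ, z + (b - 1 / 2) + (a - 1 / 2) * σ = k + l * σ := by
  rw [thetaChar_eq, mul_eq_zero, neg_eq_zero, or_iff_right (e_ne_zero _),
    theta1_eq_zero_iff hσ]

theorem thetaChar_add_one (a b : ℚ) (z σ : ℂ) :
    thetaChar a b (z + 1) σ = e a * thetaChar a b z σ := by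
  simp only [thetaChar]
  rw [← tsum_mul_left]
  refine tsum_congr fun m => ?_
  have h : e (m + a) = e a := by rw [e_add, e_int, one_mul]
  rw [← h, e, ← Complex.exp_add]
  congr 1
  ring

theorem thetaChar_add_tau (a b : ℚ) (z σ : ℂ) :
    thetaChar a b (z + σ) σ = e (-σ / 2 - z - b) * thetaChar a b z σ := by
  simp only [thetaChar]
  rw [← tsum_mul_left, ← (Equiv.addRight (1 : ℤ)).tsum_eq (fun m : ℤ =>
    e (-σ / 2 - z - b) * cexp (π * I * (m + a) ^ 2 * σ + 2 * π * I * (m + a) * (z + b)))]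
  refine tsum_congr fun m => ?_
  rw [e, ← Complex.exp_add]
  congr 1
  simp only [Equiv.coe_addRight]
  push_cast
  ring

theorem thetaChar_add_char (a b : ℚ) (z σ : ℂ) :
    thetaChar (a + 1) b z σ = thetaChar a b z σ := by
  simp only [thetaChar]
  rw [← (Equiv.addRight (1 : ℤ)).tsum_eq (fun m : ℤ =>
    cexp (π * I * (m + a) ^ 2 * σ + 2 * π * I * (m + a) * (z + b)))]
  refine tsum_congr fun m => ?_
  simp only [Equiv.coe_addRight]
  congr 1
  push_cast
  ring

theorem stdAddChar_intCast {n : ℕ} [NeZero n] (j : ℤ) :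
    ZMod.stdAddChar (j : ZMod n) = e (j / n) := by
  rw [ZMod.stdAddChar_coe, e]; congr 1; ring

theorem stdAddChar_eq {n : ℕ} [NeZero n] (a : ZMod n) : ZMod.stdAddChar a = e (a.val / n) := by
  have := stdAddChar_intCast (n := n) a.val
  simpa using this

theorem psi_add_one_div {n : ℕ} [NeZero n] (τ : ℍ) (a : ZMod n) (z : ℂ) :
    psi n τ a (z + 1 / n) = ZMod.stdAddChar a * e (-(n - 1) / 2 / n) * psi n τ a z := by
  simp only [psi]
  rw [← tsum_mul_left]
  refine tsum_congr fun m => ?_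
  have h : ZMod.stdAddChar a = e (m.1 / n) := by rw [← stdAddChar_intCast, m.2]
  rw [h, e, e, ← Complex.exp_add, ← Complex.exp_add]
  congr 1
  ring

theorem psi_add_nat_div {n : ℕ} [NeZero n] (τ : ℍ) (a : ZMod n) (k : ℕ) (z : ℂ) :
    psi n τ a (z + k / n) =
      ZMod.stdAddChar ((k : ZMod n) * a) * e (-k * (n - 1) / 2 / n) * psi n τ a z := by
  induction k with
  | zero => simp [e_zero]
  | succ k ih =>
    have h1 : z + (k + 1 : ℕ) / (n : ℂ) = z + k / n + 1 / n := by push_cast; ring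
    have h2 : e (-(k + 1 : ℕ) * (n - 1) / 2 / n) =
        e (-(n - 1) / 2 / n) * e (-k * (n - 1) / 2 / n) := by
      rw [← e_add]; congr 1; push_cast; ring
    have h3 : ((k + 1 : ℕ) : ZMod n) * a = a + k * a := by push_cast; ring
    rw [h1, psi_add_one_div, ih, h2, h3, AddChar.map_add_eq_mul]
    ring

theorem e_neg_half_pred {n : ℕ} [NeZero n] : e (-(n - 1) / 2) = (-1) ^ (n - 1) := by
  have hn : 1 ≤ n := Nat.one_le_iff_ne_zero.2 (NeZero.ne n)
  rw [← e_neg_half, ← e_nat_mul]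
  congr 1
  push_cast [Nat.cast_sub hn]
  ring

theorem psi_add_one {n : ℕ} [NeZero n] (τ : ℍ) (a : ZMod n) (z : ℂ) :
    psi n τ a (z + 1) = (-1) ^ (n - 1) * psi n τ a z := by
  have hn : (n : ℂ) ≠ 0 := NeZero.ne _
  have h := psi_add_nat_div τ a n z
  have h2 : -(n : ℂ) * (n - 1) / 2 / n = -(n - 1) / 2 := by field_simp
  rwa [div_self hn, ZMod.natCast_self, zero_mul, AddChar.map_zero_eq_one, one_mul, h2,
    e_neg_half_pred] at h

theorem psi_add_tau_div {n : ℕ} [NeZero n] (τ : ℍ) (a : ZMod n) (z : ℂ) :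
    psi n τ a (z + τ / n) = e (-τ / (2 * n) - z) * psi n τ (a + 1) z := by
  have hn : (n : ℂ) ≠ 0 := NeZero.ne _
  simp only [psi]
  rw [← tsum_mul_left]
  have hE : ∀ m : ℤ, (m : ZMod n) = a ↔ ((Equiv.addRight (1 : ℤ) m : ℤ) : ZMod n) = a + 1 := by
    intro m; simp
  conv_rhs => rw [← ((Equiv.addRight (1 : ℤ)).subtypeEquiv hE).tsum_eq]
  refine tsum_congr fun m => ?_
  rw [e, ← Complex.exp_add]
  congr 1
  simp only [Equiv.subtypeEquiv_apply, Equiv.coe_addRight]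
  push_cast
  field_simp
  ring

theorem psi_add_nat_tau_div {n : ℕ} [NeZero n] (τ : ℍ) (a : ZMod n) (k : ℕ) (z : ℂ) :
    psi n τ a (z + k * τ / n) = e (-k ^ 2 * τ / (2 * n) - k * z) * psi n τ (a + k) z := by
  have hn : (n : ℂ) ≠ 0 := NeZero.ne _
  induction k generalizing a with
  | zero => simp [e_zero]
  | succ k ih =>
    have h1 : z + (k + 1 : ℕ) * (τ : ℂ) / n = z + k * τ / n + τ / n := by push_cast; ring
    have h2 : e (-(k + 1 : ℕ) ^ 2 * τ / (2 * n) - (k + 1 : ℕ) * z) =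
        e (-τ / (2 * n) - (z + k * τ / n)) * e (-k ^ 2 * τ / (2 * n) - k * z) := by
      rw [← e_add]; congr 1; push_cast; field_simp; ring
    have h3 : a + 1 + (k : ZMod n) = a + (k + 1 : ℕ) := by push_cast; ring
    rw [h1, psi_add_tau_div, ih, h2, h3]
    ring

theorem psi_add_tau {n : ℕ} [NeZero n] (τ : ℍ) (a : ZMod n) (z : ℂ) :
    psi n τ a (z + τ) = e (-n * τ / 2 - n * z) * psi n τ a z := by
  have hn : (n : ℂ) ≠ 0 := NeZero.ne _
  have h := psi_add_nat_tau_div τ a n z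
  have h1 : (n : ℂ) * τ / n = τ := by field_simp
  have h2 : -(n : ℂ) ^ 2 * τ / (2 * n) = -n * τ / 2 := by field_simp
  rwa [h1, h2, ZMod.natCast_self, add_zero] at h

/-- The parametrization `k ↦ a.val + n k` of the integers congruent to `a` modulo `n`. -/
def residueEquiv {n : ℕ} [NeZero n] (a : ZMod n) : ℤ ≃ {m : ℤ // (m : ZMod n) = a} :=
  Equiv.ofBijective (fun k => ⟨a.val + n * k, by simp⟩) <| by
    have hn : (n : ℤ) ≠ 0 := by exact_mod_cast NeZero.ne n
    constructor
    · intro k l h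
      have h' : (a.val : ℤ) + n * k = a.val + n * l := congrArg Subtype.val h
      exact mul_left_cancel₀ hn (add_left_cancel h')
    · rintro ⟨m, hm⟩
      have h1 : ((a.val : ℤ) : ZMod n) = (m : ZMod n) := by simp [hm]
      obtain ⟨k, hk⟩ := (ZMod.intCast_eq_intCast_iff_dvd_sub _ _ _).1 h1
      exact ⟨k, Subtype.ext (by simp only; linarith)⟩

theorem psi_eq_thetaChar {n : ℕ} [NeZero n] (τ : ℍ) (a : ZMod n) (z : ℂ) :
    psi n τ a z = thetaChar ((a.val - (n - 1) / 2) / n) 0 (n * z) (n * τ) := by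
  have hn : (n : ℂ) ≠ 0 := NeZero.ne _
  simp only [psi, thetaChar]
  rw [← (residueEquiv a).tsum_eq]
  refine tsum_congr fun k => ?_
  have h : ((residueEquiv a k).1 : ℂ) = a.val + n * k := by
    change (((a.val : ℤ) + n * k : ℤ) : ℂ) = _
    push_cast; rfl
  rw [h]
  congr 1
  push_cast
  field_simp
  ring

theorem im_nat_mul_pos (n : ℕ) [NeZero n] (τ : ℍ) : 0 < ((n : ℂ) * τ).im := by
  have hn : (0 : ℝ) < n := by exact_mod_cast Nat.pos_of_ne_zero (NeZero.ne n)
  simpa using mul_pos hn τ.im_pos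

theorem differentiable_psi {n : ℕ} [NeZero n] (τ : ℍ) (a : ZMod n) :
    Differentiable ℂ (psi n τ a) := by
  have h := differentiable_thetaChar ((a.val - (n - 1) / 2) / n) 0 (im_nat_mul_pos n τ)
  have h2 : psi n τ a = fun z => thetaChar ((a.val - (n - 1) / 2) / n) 0 (n * z) (n * τ) :=
    funext (psi_eq_thetaChar τ a)
  rw [h2]
  exact h.comp (by fun_prop : Differentiable ℂ fun z : ℂ => n * z)

theorem exists_thetaChar_ne_zero (a b : ℚ) {σ : ℂ} (hσ : 0 < σ.im) :
    ∃ z, thetaChar a b z σ ≠ 0 := by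
  obtain ⟨y, hy⟩ := exists_theta1_ne_zero hσ
  refine ⟨y - (b - 1 / 2) - (a - 1 / 2) * σ, ?_⟩
  rw [thetaChar_eq]
  refine mul_ne_zero (neg_ne_zero.2 (e_ne_zero _)) ?_
  ring_nf at hy ⊢
  exact hy

theorem exists_psi_ne_zero {n : ℕ} [NeZero n] (τ : ℍ) (a : ZMod n) : ∃ z, psi n τ a z ≠ 0 := by
  have hn : (n : ℂ) ≠ 0 := NeZero.ne _
  obtain ⟨z, hz⟩ := exists_thetaChar_ne_zero ((a.val - (n - 1) / 2) / n) 0 (im_nat_mul_pos n τ)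
  refine ⟨z / n, ?_⟩
  rw [psi_eq_thetaChar]
  rwa [mul_div_cancel₀ _ hn]

/-- Inversion of the discrete Fourier transform. -/
theorem sum_stdAddChar_mul_sum {n : ℕ} [NeZero n] (x : ZMod n → ℂ) (b : ZMod n) :
    ∑ r, ZMod.stdAddChar (-(r * b)) * ∑ a, ZMod.stdAddChar (r * a) * x a = n * x b := by
  simp only [Finset.mul_sum]
  rw [Finset.sum_comm]
  have h : ∀ a, ∑ r, ZMod.stdAddChar (-(r * b)) * (ZMod.stdAddChar (r * a) * x a) =
      if a = b then n * x a else 0 := by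
    intro a
    have := AddChar.sum_mulShift (a - b) (ZMod.isPrimitive_stdAddChar n)
    simp only [← mul_assoc, ← AddChar.map_add_eq_mul, ← Finset.sum_mul]
    have h2 : ∀ r : ZMod n, -(r * b) + r * a = r * (a - b) := fun r => by ring
    simp only [h2, this, sub_eq_zero, ZMod.card]
    split_ifs <;> simp
  simp [h]

/-- The `ψ_a` are eigenfunctions of the translation by `1/n` with different eigenvalues. -/
theorem psi_linearIndependent {n : ℕ} [NeZero n] (τ : ℍ) (c : ZMod n → ℂ)
    (h : ∀ z, ∑ a, c a * psi n τ a z = 0) (a : ZMod n) : c a = 0 := by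
  have hn : (n : ℂ) ≠ 0 := NeZero.ne _
  obtain ⟨z, hz⟩ := exists_psi_ne_zero τ a
  have h1 : ∀ r : ZMod n, ∑ b, ZMod.stdAddChar (r * b) * (c b * psi n τ b z) = 0 := by
    intro r
    have h2 := h (z + r.val / n)
    simp only [psi_add_nat_div, ZMod.natCast_zmod_val] at h2
    have h3 : e (-r.val * (n - 1) / 2 / n) *
        ∑ b, ZMod.stdAddChar (r * b) * (c b * psi n τ b z) = 0 := by
      rw [← h2, Finset.mul_sum]
      exact Finset.sum_congr rfl fun b _ => by ring
    exact (mul_eq_zero.1 h3).resolve_left (e_ne_zero _)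
  have h4 := sum_stdAddChar_mul_sum (fun b => c b * psi n τ b z) a
  simp only [h1, mul_zero, Finset.sum_const_zero] at h4
  simpa [hn, hz] using h4.symm

/-- A function on `ℂ` with the transformation laws of `thetaSpace` is a combination of the `ψ_a`:
its projections to the eigenspaces of the translation by `1/n` are theta functions of degree one
for the lattice `ℤ/n + ℤτ`. -/
theorem exists_eq_sum_psi {n : ℕ} [NeZero n] (τ : ℍ) {f : ℂ → ℂ} (hf : Differentiable ℂ f)
    (f1 : ∀ z, f (z + 1) = (-1) ^ (n - 1) * f z)
    (f2 : ∀ z, f (z + τ) = e (-n * τ / 2 - n * z) * f z) :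
    ∃ c : ZMod n → ℂ, ∀ z, f z = ∑ a, c a * psi n τ a z := by
  have hn : (n : ℂ) ≠ 0 := NeZero.ne _
  set s : ℂ := (n - 1) / 2 / n with hs
  -- the translates of `f` by `r/n`, normalized so that they depend on `r` modulo `n` only
  set F : ZMod n → ℂ → ℂ := fun r z => e (s * r.val) * f (z + r.val / n) with hF
  have hFd : ∀ r, Differentiable ℂ (F r) := fun r => by fun_prop
  have F1 : ∀ r z, F r (z + 1 / n) = e (-s) * F (r + 1) z := by
    intro r z
    simp only [hF]
    have hr : r + 1 = ((r.val + 1 : ℕ) : ZMod n) := by simp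
    have hz : z + 1 / n + r.val / (n : ℂ) = z + (r.val + 1 : ℕ) / n := by push_cast; ring
    rw [hr, ZMod.val_natCast, hz]
    rcases Nat.lt_or_ge (r.val + 1) n with h | h
    · have hs2 : s * r.val = -s + s * (r.val + 1 : ℕ) := by push_cast; ring
      rw [Nat.mod_eq_of_lt h, hs2, e_add, mul_assoc]
    · have h' : r.val + 1 = n := le_antisymm r.val_lt h
      have hrv : (r.val : ℂ) = n - 1 := by
        have : ((r.val + 1 : ℕ) : ℂ) = n := congrArg Nat.cast h'
        rw [← this]; push_cast; ring
      have hs2 : s * (n - 1) = -s + (-1 / 2 + n / 2) := by rw [hs]; field_simp; ring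
      have hs3 : -1 / 2 + (n : ℂ) / 2 = -(n - 1) / 2 + (n - 1 : ℤ) := by push_cast; ring
      rw [h', Nat.mod_self, hrv, div_self hn, f1, hs2, e_add, hs3, e_add, e_int, mul_one,
        e_neg_half_pred]
      simp only [Nat.cast_zero, mul_zero, e_zero, zero_div, add_zero, one_mul]
      rw [mul_assoc, ← mul_assoc ((-1 : ℂ) ^ (n - 1)), ← mul_pow]
      simp
  have F2 : ∀ r z, F r (z + τ) = e (-n * τ / 2 - n * z) * F r z := by
    intro r z
    simp only [hF]
    rw [add_right_comm, f2]
    have h : -(n : ℂ) * τ / 2 - n * (z + r.val / n) =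
        -n * τ / 2 - n * z + (-(r.val : ℤ) : ℤ) := by
      push_cast; field_simp; ring
    rw [h, e_add, e_int]; ring
  -- `n` times the projection of `f` to the eigenspace of `ψ_a`
  set g : ZMod n → ℂ → ℂ := fun a z => ∑ r, ZMod.stdAddChar (-(r * a)) * F r z with hg
  have hgd : ∀ a, Differentiable ℂ (g a) := fun a => by fun_prop
  have g1 : ∀ a z, g a (z + 1 / n) = ZMod.stdAddChar a * e (-s) * g a z := by
    intro a z
    simp only [hg, F1]
    rw [← Equiv.sum_comp (Equiv.addRight (1 : ZMod n))
        (fun r => ZMod.stdAddChar (-(r * a)) * F r z),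
      Finset.mul_sum]
    refine Finset.sum_congr rfl fun r _ => ?_
    simp only [Equiv.coe_addRight]
    have h : (-(r * a) : ZMod n) = a + -((r + 1) * a) := by ring
    rw [h, AddChar.map_add_eq_mul]; ring
  have g2 : ∀ a z, g a (z + τ) = e (-n * τ / 2 - n * z) * g a z := by
    intro a z
    simp only [hg, F2]
    rw [Finset.mul_sum]
    exact Finset.sum_congr rfl fun r _ => by ring
  have hsum : ∀ z, ∑ a, g a z = n * f z := by
    intro z
    have h := sum_stdAddChar_mul_sum (fun r => F (-r) z) 0
    simp only [mul_zero, neg_zero, AddChar.map_zero_eq_one, one_mul] at h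
    have h0 : F 0 z = f z := by simp [hF, e_zero]
    rw [← h0, ← h]
    refine Finset.sum_congr rfl fun a _ => ?_
    simp only [hg]
    rw [← Equiv.sum_comp (Equiv.neg (ZMod n))]
    exact Finset.sum_congr rfl fun r _ => by simp [mul_comm]
  have hC : ∀ a, ∃ C, ∀ z, g a z = C * psi n τ a z := by
    intro a
    obtain ⟨C, hC⟩ := exists_eq_const_mul_of_degree_one (σ := n * τ) (p := a.val / n - s) (q := 0)
      (im_nat_mul_pos n τ) (f := fun z => g a (z / n)) (g := fun z => psi n τ a (z / n))
      ((hgd a).comp (by fun_prop)) ((differentiable_psi τ a).comp (by fun_prop))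
      (by
        obtain ⟨z, hz⟩ := exists_psi_ne_zero τ a
        exact ⟨n * z, by rwa [mul_div_cancel_left₀ _ hn]⟩)
      (fun z => by
        rw [add_div, g1, sub_eq_add_neg, e_add, stdAddChar_eq])
      (fun z => by
        have h : -(n - 1) / 2 / n = -s := by rw [hs]; ring
        rw [add_div, psi_add_one_div, h, sub_eq_add_neg, e_add, stdAddChar_eq])
      (fun z => by
        rw [add_div, mul_div_cancel_left₀ _ hn, g2, mul_div_cancel₀ _ hn]
        congr 2; ring)
      (fun z => by
        rw [add_div, mul_div_cancel_left₀ _ hn, psi_add_tau, mul_div_cancel₀ _ hn]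
        congr 2; ring)
    exact ⟨C, fun z => by simpa [mul_div_cancel_left₀ _ hn] using hC (n * z)⟩
  choose C hC using hC
  refine ⟨fun a => C a / n, fun z => ?_⟩
  have h := hsum z
  simp only [hC] at h
  rw [eq_comm, ← mul_right_inj' hn, ← h, Finset.mul_sum]
  refine Finset.sum_congr rfl fun a _ => ?_
  field_simp

/-! ### The entries of Belavin's matrix -/

/-- The coefficient of `e_k ⊗ e_l` in Belavin's `R_B(lam) (e_i ⊗ e_j)`, as a function of
`d = i - k` and `m = k - j`: the discrete Fourier transform of the weights. -/
def belavinEntry (n : ℕ) [NeZero n] (τ : ℍ) (κ : ℂ) (d m : ZMod n) (lam : ℂ) : ℂ :=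
  ∑ a : ZMod n, ZMod.stdAddChar (a * m) * belavinWeight n τ (-κ / n) lam (a, d)

theorem differentiable_belavinEntry {n : ℕ} [NeZero n] (τ : ℍ) (κ : ℂ) (d m : ZMod n) :
    Differentiable ℂ (belavinEntry n τ κ d m) := by
  unfold belavinEntry belavinWeight
  refine Differentiable.fun_sum fun a _ =>
    Differentiable.const_mul (Differentiable.div_const ?_ _) _
  exact (differentiable_thetaChar _ _ τ.im_pos).comp (by fun_prop)

theorem belavinEntry_add_one {n : ℕ} [NeZero n] (τ : ℍ) (κ : ℂ) (d m : ZMod n) (lam : ℂ) :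
    belavinEntry n τ κ d m (lam + 1) = -ZMod.stdAddChar d * belavinEntry n τ κ d m lam := by
  simp only [belavinEntry, belavinWeight]
  rw [Finset.mul_sum]
  refine Finset.sum_congr rfl fun a _ => ?_
  have h : e ((1 / 2 + (d.val : ℚ) / n : ℚ) : ℂ) = -ZMod.stdAddChar d := by
    push_cast
    rw [e_add, e_half, stdAddChar_eq, neg_one_mul]
  rw [add_right_comm, thetaChar_add_one, h]
  ring

theorem belavinEntry_add_tau {n : ℕ} [NeZero n] (τ : ℍ) (κ : ℂ) (d m : ZMod n) (lam : ℂ) :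
    belavinEntry n τ κ d m (lam + τ) =
      -e (-τ / 2 - lam + κ / n) * belavinEntry n τ κ d (m + 1) lam := by
  simp only [belavinEntry, belavinWeight]
  rw [Finset.mul_sum]
  refine Finset.sum_congr rfl fun a _ => ?_
  have h : e (-τ / 2 - (lam + -κ / n) - ((1 / 2 - (a.val : ℚ) / n : ℚ) : ℂ)) =
      -e (-τ / 2 - lam + κ / n) * ZMod.stdAddChar a := by
    rw [stdAddChar_eq, ← neg_one_mul (e _), ← e_neg_half, ← e_add, ← e_add]
    congr 1
    push_cast
    ring
  have h2 : a * (m + 1) = a * m + a := by ring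
  rw [add_right_comm, thetaChar_add_tau, h, h2, AddChar.map_add_eq_mul]
  ring

theorem belavinEntry_zero {n : ℕ} [NeZero n] {τ : ℍ} {κ : ℂ} (hκ : κ ∉ periodLattice τ)
    (d m : ZMod n) : belavinEntry n τ κ d m 0 = if m = 0 then 1 else 0 := by
  have hn : (n : ℂ) ≠ 0 := NeZero.ne _
  have hw : ∀ a : ZMod n, belavinWeight n τ (-κ / n) 0 (a, d) = 1 / n := by
    intro a
    have h : thetaChar (1 / 2 + (d.val : ℚ) / n) (1 / 2 - (a.val : ℚ) / n) (-κ / n) τ ≠ 0 := by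
      rw [Ne, thetaChar_eq_zero_iff τ.im_pos]
      rintro ⟨k, l, h⟩
      refine hκ ⟨-a.val - n * k, d.val - n * l, ?_⟩
      push_cast at h ⊢
      field_simp at h
      linear_combination -h / 2
    simp only [belavinWeight, zero_add]
    rw [mul_comm, ← div_div, div_self h]
  have h := AddChar.sum_mulShift m (ZMod.isPrimitive_stdAddChar n)
  simp only [belavinEntry, hw]
  rw [← Finset.sum_mul, h, ZMod.card]
  split_ifs
  · field_simp
  · simp

/-! ### The action of the operator on `ψ_i ⊗ ψ_j` -/

/-- The difference of the two sides of the identity expressing the action of the operator on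
`ψ_i ⊗ ψ_j` through Belavin's matrix, with denominators cleared. -/
def kernelDefect (n : ℕ) [NeZero n] (τ : ℍ) (κ : ℂ) (i j : ZMod n) (z₁ z₂ lam : ℂ) : ℂ :=
  theta1 (z₁ - z₂ - (lam + κ) / n + lam) τ * theta1 κ τ *
      (psi n τ i (z₂ + lam / n) * psi n τ j (z₁ - lam / n)) -
    theta1 lam τ * theta1 (z₁ - z₂ - (lam + κ) / n + κ) τ *
      (psi n τ i (z₁ - κ / n) * psi n τ j (z₂ + κ / n)) -
    theta1 (z₁ - z₂ - (lam + κ) / n) τ * theta1 κ τ *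
      ∑ k, belavinEntry n τ κ (i - k) (k - j) lam * (psi n τ k z₁ * psi n τ (i + j - k) z₂)

/-- The simultaneous shift by `1/n` and `1` keeps `w = z₁ - z₂ - (lam + κ)/n` fixed. -/
theorem kernelDefect_add_one {n : ℕ} [NeZero n] (τ : ℍ) (κ : ℂ) (i j : ZMod n)
    (z₁ z₂ lam : ℂ) : kernelDefect n τ κ i j (z₁ + 1 / n) z₂ (lam + 1) =
      -(ZMod.stdAddChar i * e (-(n - 1) / 2 / n)) * kernelDefect n τ κ i j z₁ z₂ lam := by
  have h1 : z₁ + 1 / n - z₂ - (lam + 1 + κ) / n = z₁ - z₂ - (lam + κ) / n := by ring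
  have h2 : z₂ + (lam + 1) / n = z₂ + lam / n + 1 / n := by ring
  have h3 : z₁ + 1 / n - (lam + 1) / n = z₁ - lam / n := by ring
  have h4 : z₁ + 1 / n - κ / n = z₁ - κ / n + 1 / n := by ring
  have hs : ∑ k, belavinEntry n τ κ (i - k) (k - j) (lam + 1) *
      (psi n τ k (z₁ + 1 / n) * psi n τ (i + j - k) z₂) =
      -(ZMod.stdAddChar i * e (-(n - 1) / 2 / n)) *
        ∑ k, belavinEntry n τ κ (i - k) (k - j) lam * (psi n τ k z₁ * psi n τ (i + j - k) z₂) := by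
    rw [Finset.mul_sum]
    refine Finset.sum_congr rfl fun k _ => ?_
    have hk : ZMod.stdAddChar i = ZMod.stdAddChar (i - k) * ZMod.stdAddChar k := by
      rw [← AddChar.map_add_eq_mul, sub_add_cancel]
    rw [belavinEntry_add_one, psi_add_one_div, hk]
    ring
  simp only [kernelDefect]
  rw [hs, h1, h2, h3, h4, psi_add_one_div, psi_add_one_div, ← add_assoc, theta1_add_one,
    theta1_add_one]
  ring

/-- The simultaneous shift by `τ/n` and `τ` keeps `w = z₁ - z₂ - (lam + κ)/n` fixed and raises
the index `i`. -/
theorem kernelDefect_add_tau {n : ℕ} [NeZero n] (τ : ℍ) (κ : ℂ) (i j : ZMod n)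
    (z₁ z₂ lam : ℂ) : kernelDefect n τ κ i j (z₁ + τ / n) z₂ (lam + τ) =
      -e (-τ / 2 - lam - τ / (2 * n) - z₁ + κ / n) * kernelDefect n τ κ (i + 1) j z₁ z₂ lam := by
  have h1 : z₁ + τ / n - z₂ - (lam + τ + κ) / n = z₁ - z₂ - (lam + κ) / n := by ring
  have h2 : z₂ + (lam + τ) / n = z₂ + lam / n + τ / n := by ring
  have h3 : z₁ + τ / n - (lam + τ) / n = z₁ - lam / n := by ring
  have h4 : z₁ + τ / n - κ / n = z₁ - κ / n + τ / n := by ring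
  have e1 : e (-τ / 2 - lam - τ / (2 * n) - z₁ + κ / n) =
      e (-τ / 2 - (z₁ - z₂ - (lam + κ) / n + lam)) * e (-τ / (2 * n) - (z₂ + lam / n)) := by
    rw [← e_add]; congr 1; ring
  have e2 : e (-τ / 2 - lam - τ / (2 * n) - z₁ + κ / n) =
      e (-τ / 2 - lam) * e (-τ / (2 * n) - (z₁ - κ / n)) := by
    rw [← e_add]; congr 1; ring
  have e3 : e (-τ / 2 - lam - τ / (2 * n) - z₁ + κ / n) =
      e (-τ / 2 - lam + κ / n) * e (-τ / (2 * n) - z₁) := by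
    rw [← e_add]; congr 1; ring
  have hs : ∑ k, belavinEntry n τ κ (i - k) (k - j) (lam + τ) *
      (psi n τ k (z₁ + τ / n) * psi n τ (i + j - k) z₂) =
      -e (-τ / 2 - lam - τ / (2 * n) - z₁ + κ / n) *
        ∑ k, belavinEntry n τ κ (i + 1 - k) (k - j) lam *
          (psi n τ k z₁ * psi n τ (i + 1 + j - k) z₂) := by
    rw [← Equiv.sum_comp (Equiv.addRight (1 : ZMod n)) (fun k =>
      belavinEntry n τ κ (i + 1 - k) (k - j) lam * (psi n τ k z₁ * psi n τ (i + 1 + j - k) z₂)),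
      Finset.mul_sum]
    refine Finset.sum_congr rfl fun k _ => ?_
    simp only [Equiv.coe_addRight]
    have k1 : i + 1 - (k + 1) = i - k := by ring
    have k2 : k + 1 - j = k - j + 1 := by ring
    have k3 : i + 1 + j - (k + 1) = i + j - k := by ring
    rw [belavinEntry_add_tau, psi_add_tau_div, k1, k2, k3, e3]
    ring
  simp only [kernelDefect]
  rw [hs, h1, h2, h3, h4, psi_add_tau_div, psi_add_tau_div, ← add_assoc, theta1_add_tau,
    theta1_add_tau]
  linear_combination theta1 (z₁ - z₂ - (lam + κ) / n + lam) τ * theta1 κ τ *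
      (psi n τ (i + 1) (z₂ + lam / n) * psi n τ j (z₁ - lam / n)) * e1 -
    theta1 lam τ * theta1 (z₁ - z₂ - (lam + κ) / n + κ) τ *
      (psi n τ (i + 1) (z₁ - κ / n) * psi n τ j (z₂ + κ / n)) * e2

theorem kernelDefect_fst_add_one {n : ℕ} [NeZero n] (τ : ℍ) (κ : ℂ) (i j : ZMod n)
    (z₁ z₂ lam : ℂ) : kernelDefect n τ κ i j (z₁ + 1) z₂ lam =
      -(-1) ^ (n - 1) * kernelDefect n τ κ i j z₁ z₂ lam := by
  have h1 : z₁ + 1 - z₂ - (lam + κ) / n = z₁ - z₂ - (lam + κ) / n + 1 := by ring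
  have h3 : z₁ + 1 - lam / n = z₁ - lam / n + 1 := by ring
  have h4 : z₁ + 1 - κ / n = z₁ - κ / n + 1 := by ring
  simp only [kernelDefect]
  rw [h1, h3, h4, add_right_comm _ 1 lam, add_right_comm _ 1 κ]
  simp only [psi_add_one, theta1_add_one]
  have hs : ∑ k, belavinEntry n τ κ (i - k) (k - j) lam *
      ((-1) ^ (n - 1) * psi n τ k z₁ * psi n τ (i + j - k) z₂) = (-1) ^ (n - 1) *
      ∑ k, belavinEntry n τ κ (i - k) (k - j) lam * (psi n τ k z₁ * psi n τ (i + j - k) z₂) := by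
    rw [Finset.mul_sum]
    exact Finset.sum_congr rfl fun k _ => by ring
  rw [hs]
  ring

theorem kernelDefect_fst_add_tau {n : ℕ} [NeZero n] (τ : ℍ) (κ : ℂ) (i j : ZMod n)
    (z₁ z₂ lam : ℂ) : kernelDefect n τ κ i j (z₁ + τ) z₂ lam =
      -e (-τ / 2 - (z₁ - z₂ - (lam + κ) / n) - n * τ / 2 - n * z₁) *
        kernelDefect n τ κ i j z₁ z₂ lam := by
  have hn : (n : ℂ) ≠ 0 := NeZero.ne _
  have h1 : z₁ + τ - z₂ - (lam + κ) / n = z₁ - z₂ - (lam + κ) / n + τ := by ring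
  have h3 : z₁ + τ - lam / n = z₁ - lam / n + τ := by ring
  have h4 : z₁ + τ - κ / n = z₁ - κ / n + τ := by ring
  set w := z₁ - z₂ - (lam + κ) / n with hw
  have e1 : e (-τ / 2 - w - n * τ / 2 - n * z₁) =
      e (-τ / 2 - (w + lam)) * e (-n * τ / 2 - n * (z₁ - lam / n)) := by
    rw [← e_add]; congr 1; field_simp; ring
  have e2 : e (-τ / 2 - w - n * τ / 2 - n * z₁) =
      e (-τ / 2 - (w + κ)) * e (-n * τ / 2 - n * (z₁ - κ / n)) := by
    rw [← e_add]; congr 1; field_simp; ring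
  have e3 : e (-τ / 2 - w - n * τ / 2 - n * z₁) =
      e (-τ / 2 - w) * e (-n * τ / 2 - n * z₁) := by
    rw [← e_add]; congr 1; ring
  have hs : ∑ k, belavinEntry n τ κ (i - k) (k - j) lam *
      (psi n τ k (z₁ + τ) * psi n τ (i + j - k) z₂) = e (-n * τ / 2 - n * z₁) *
      ∑ k, belavinEntry n τ κ (i - k) (k - j) lam * (psi n τ k z₁ * psi n τ (i + j - k) z₂) := by
    rw [Finset.mul_sum]
    exact Finset.sum_congr rfl fun k _ => by rw [psi_add_tau]; ring
  simp only [kernelDefect]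
  rw [hs, h1, h3, h4, add_right_comm _ (τ : ℂ) lam, add_right_comm _ (τ : ℂ) κ]
  simp only [psi_add_tau, theta1_add_tau, ← hw]
  linear_combination theta1 (w + lam) τ * theta1 κ τ *
      (psi n τ i (z₂ + lam / n) * psi n τ j (z₁ - lam / n)) * e1 -
    theta1 lam τ * theta1 (w + κ) τ *
      (psi n τ i (z₁ - κ / n) * psi n τ j (z₂ + κ / n)) * e2 -
    theta1 w τ * theta1 κ τ * (∑ k, belavinEntry n τ κ (i - k) (k - j) lam *
      (psi n τ k z₁ * psi n τ (i + j - k) z₂)) * e3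

/-- At `lam = 0` both the operator and Belavin's matrix reduce to the flip. -/
theorem kernelDefect_zero {n : ℕ} [NeZero n] {τ : ℍ} {κ : ℂ} (hκ : κ ∉ periodLattice τ)
    (i j : ZMod n) (z₁ z₂ : ℂ) : kernelDefect n τ κ i j z₁ z₂ 0 = 0 := by
  have hs : ∑ k, belavinEntry n τ κ (i - k) (k - j) 0 *
      (psi n τ k z₁ * psi n τ (i + j - k) z₂) = psi n τ j z₁ * psi n τ i z₂ := by
    simp only [belavinEntry_zero hκ, sub_eq_zero, ite_mul, one_mul, zero_mul]
    rw [Finset.sum_ite_eq' Finset.univ j]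
    simp
  simp only [kernelDefect]
  rw [hs]
  simp only [theta1_zero, zero_div, add_zero, sub_zero]
  ring

theorem kernelDefect_eq_zero_of_lattice {n : ℕ} [NeZero n] {τ : ℍ} {κ : ℂ}
    (hκ : κ ∉ periodLattice τ) (i j : ZMod n) (z₁ z₂ : ℂ) {lam : ℂ}
    (hlam : theta1 lam τ = 0) : kernelDefect n τ κ i j z₁ z₂ lam = 0 := by
  obtain ⟨a, b, rfl⟩ := (theta1_eq_zero_iff τ.im_pos).1 hlam
  refine lattice_induction (P := fun lam => ∀ (i j : ZMod n) (z₁ z₂ : ℂ),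
    kernelDefect n τ κ i j z₁ z₂ lam = 0) (kernelDefect_zero hκ) (fun lam => ?_) (fun lam => ?_)
    a b i j z₁ z₂
  · have key := fun i j z₁ z₂ => kernelDefect_add_one (n := n) τ κ i j z₁ z₂ lam
    have hχ : ∀ i : ZMod n, ZMod.stdAddChar i ≠ (0 : ℂ) := fun i => by
      rw [stdAddChar_eq]; exact e_ne_zero _
    refine ⟨fun h i j z₁ z₂ => ?_, fun h i j z₁ z₂ => ?_⟩
    · have := key i j z₁ z₂
      rw [h, eq_comm, mul_eq_zero] at this
      exact this.resolve_left (neg_ne_zero.2 (mul_ne_zero (hχ i) (e_ne_zero _)))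
    · have := key i j (z₁ - 1 / n) z₂
      rwa [h, mul_zero, sub_add_cancel] at this
  · have key := fun i j z₁ z₂ => kernelDefect_add_tau (n := n) τ κ i j z₁ z₂ lam
    refine ⟨fun h i j z₁ z₂ => ?_, fun h i j z₁ z₂ => ?_⟩
    · have := key (i - 1) j z₁ z₂
      rw [h, eq_comm, mul_eq_zero, sub_add_cancel] at this
      exact this.resolve_left (neg_ne_zero.2 (e_ne_zero _))
    · have := key i j (z₁ - τ / n) z₂
      rwa [h, mul_zero, sub_add_cancel] at this

/-- The residues of the two terms of the operator along `w = z₁ - z₂ - (lam + κ)/n = 0` cancel. -/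
theorem kernelDefect_eq_zero_of_diagonal {n : ℕ} [NeZero n] (τ : ℍ) (κ : ℂ) (i j : ZMod n)
    {z₁ z₂ lam : ℂ} (hw : theta1 (z₁ - z₂ - (lam + κ) / n) τ = 0) :
    kernelDefect n τ κ i j z₁ z₂ lam = 0 := by
  obtain ⟨a, b, hab⟩ := (theta1_eq_zero_iff τ.im_pos).1 hw
  refine lattice_induction (P := fun w => ∀ z₁, z₁ - z₂ - (lam + κ) / n = w →
    kernelDefect n τ κ i j z₁ z₂ lam = 0) (fun z₁ h => ?_) (fun w => ?_) (fun w => ?_) a b z₁ hab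
  · have h1 : z₁ - lam / n = z₂ + κ / n := by linear_combination h
    have h2 : z₁ - κ / n = z₂ + lam / n := by linear_combination h
    simp only [kernelDefect]
    rw [h, h1, h2, theta1_zero, zero_add, zero_add]
    ring
  · refine ⟨fun h z₁ hz => ?_, fun h z₁ hz => ?_⟩
    · have := h (z₁ + 1) (by linear_combination hz)
      rw [kernelDefect_fst_add_one, mul_eq_zero] at this
      exact this.resolve_left (neg_ne_zero.2 (pow_ne_zero _ (by norm_num)))
    · have := kernelDefect_fst_add_one τ κ i j (z₁ - 1) z₂ lam
      rwa [h (z₁ - 1) (by linear_combination hz), mul_zero, sub_add_cancel] at this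
  · refine ⟨fun h z₁ hz => ?_, fun h z₁ hz => ?_⟩
    · have := h (z₁ + τ) (by linear_combination hz)
      rw [kernelDefect_fst_add_tau, mul_eq_zero] at this
      exact this.resolve_left (neg_ne_zero.2 (e_ne_zero _))
    · have := kernelDefect_fst_add_tau τ κ i j (z₁ - τ) z₂ lam
      rwa [h (z₁ - τ) (by linear_combination hz), mul_zero, sub_add_cancel] at this

theorem kernelDefect_add_nat {n : ℕ} [NeZero n] (τ : ℍ) (κ : ℂ) (i j : ZMod n)
    (z₁ z₂ lam : ℂ) (k : ℕ) : kernelDefect n τ κ i j (z₁ + k / n) z₂ (lam + k) =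
      (-(ZMod.stdAddChar i * e (-(n - 1) / 2 / n))) ^ k * kernelDefect n τ κ i j z₁ z₂ lam := by
  induction k with
  | zero => simp
  | succ k ih =>
    have h1 : z₁ + (k + 1 : ℕ) / (n : ℂ) = z₁ + k / n + 1 / n := by push_cast; ring
    have h2 : lam + (k + 1 : ℕ) = lam + k + 1 := by push_cast; ring
    rw [h1, h2, kernelDefect_add_one, ih, pow_succ]
    ring

theorem kernelDefect_add_nat_tau {n : ℕ} [NeZero n] (τ : ℍ) (κ : ℂ) (i j : ZMod n)
    (z₁ z₂ lam : ℂ) (k : ℕ) : kernelDefect n τ κ i j (z₁ + k * τ / n) z₂ (lam + k * τ) =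
      (-1) ^ k * e (-k ^ 2 * τ / 2 - k * lam - k ^ 2 * τ / (2 * n) - k * z₁ + k * κ / n) *
        kernelDefect n τ κ (i + k) j z₁ z₂ lam := by
  have hn : (n : ℂ) ≠ 0 := NeZero.ne _
  induction k generalizing i with
  | zero => simp [e_zero]
  | succ k ih =>
    have h1 : z₁ + (k + 1 : ℕ) * τ / (n : ℂ) = z₁ + k * τ / n + τ / n := by push_cast; ring
    have h2 : lam + (k + 1 : ℕ) * τ = lam + k * τ + τ := by push_cast; ring
    have h3 : e (-(k + 1 : ℕ) ^ 2 * τ / 2 - (k + 1 : ℕ) * lam - (k + 1 : ℕ) ^ 2 * τ / (2 * n) -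
        (k + 1 : ℕ) * z₁ + (k + 1 : ℕ) * κ / n) =
        e (-τ / 2 - (lam + k * τ) - τ / (2 * n) - (z₁ + k * τ / n) + κ / n) *
        e (-k ^ 2 * τ / 2 - k * lam - k ^ 2 * τ / (2 * n) - k * z₁ + k * κ / n) := by
      rw [← e_add]; congr 1; push_cast; field_simp; ring
    have h4 : i + 1 + (k : ZMod n) = i + (k + 1 : ℕ) := by push_cast; ring
    rw [h1, h2, kernelDefect_add_tau, ih, h3, h4, pow_succ]
    ring

theorem kernelDefect_add_period {n : ℕ} [NeZero n] (τ : ℍ) (κ : ℂ) (i j : ZMod n)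
    (z₁ z₂ lam : ℂ) : kernelDefect n τ κ i j z₁ z₂ (lam + n) =
      (-1) ^ (n - 1) * kernelDefect n τ κ i j z₁ z₂ lam := by
  have hn : (n : ℂ) ≠ 0 := NeZero.ne _
  have h := kernelDefect_add_nat τ κ i j z₁ z₂ lam n
  have hχ : (ZMod.stdAddChar i : ℂ) ^ n = 1 := by
    rw [← AddChar.map_nsmul_eq_pow]; simp
  have hE : e (-(n - 1) / 2 / n) ^ n = (-1) ^ (n - 1) := by
    rw [← e_nat_mul, mul_div_cancel₀ _ hn, e_neg_half_pred]
  have hone : ((-1 : ℂ) ^ (n - 1)) * (-1) ^ (n - 1) = 1 := by rw [← mul_pow]; simp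
  have hpow : (-1 : ℂ) ^ n = -(-1) ^ (n - 1) := by
    obtain ⟨m, hm⟩ : ∃ m, n = m + 1 := Nat.exists_eq_succ_of_ne_zero (NeZero.ne n)
    rw [hm, pow_succ]; simp
  rw [div_self hn, kernelDefect_fst_add_one, neg_pow (ZMod.stdAddChar i * _), mul_pow, hχ, hE,
    one_mul, hpow] at h
  linear_combination (-(-1) ^ (n - 1)) * h -
    (kernelDefect n τ κ i j z₁ z₂ (lam + n) -
      (-1) ^ (n - 1) * kernelDefect n τ κ i j z₁ z₂ lam) * hone

theorem kernelDefect_add_period_tau {n : ℕ} [NeZero n] (τ : ℍ) (κ : ℂ) (i j : ZMod n)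
    (z₁ z₂ lam : ℂ) : kernelDefect n τ κ i j z₁ z₂ (lam + n * τ) =
      -(-1) ^ n * e (-n ^ 2 * τ / 2 - n * lam + κ - τ / 2 + (z₁ - z₂ - (lam + κ) / n)) *
        kernelDefect n τ κ i j z₁ z₂ lam := by
  have hn : (n : ℂ) ≠ 0 := NeZero.ne _
  have h := kernelDefect_add_nat_tau τ κ i j z₁ z₂ lam n
  have h1 : z₁ + n * τ / n = z₁ + τ := by field_simp
  rw [h1, kernelDefect_fst_add_tau, ZMod.natCast_self, add_zero] at h
  set E := e (-τ / 2 - (z₁ - z₂ - (lam + n * τ + κ) / n) - n * τ / 2 - n * z₁) with hE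
  have h2 : e (-n ^ 2 * τ / 2 - n * lam - n ^ 2 * τ / (2 * n) - n * z₁ + n * κ / n) =
      E * e (-n ^ 2 * τ / 2 - n * lam + κ - τ / 2 + (z₁ - z₂ - (lam + κ) / n)) := by
    rw [hE, ← e_add]; congr 1; field_simp; ring
  rw [h2] at h
  have hE0 : E ≠ 0 := e_ne_zero _
  apply mul_left_cancel₀ hE0
  linear_combination -h

theorem differentiable_kernelDefect_lam {n : ℕ} [NeZero n] (τ : ℍ) (κ : ℂ) (i j : ZMod n)
    (z₁ z₂ : ℂ) : Differentiable ℂ fun lam => kernelDefect n τ κ i j z₁ z₂ lam := by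
  have hθ := differentiable_theta1 τ
  have hψ := fun a : ZMod n => differentiable_psi τ a
  have hb := fun a b : ZMod n => differentiable_belavinEntry τ κ a b
  have t1 : Differentiable ℂ fun lam : ℂ => theta1 (z₁ - z₂ - (lam + κ) / n + lam) τ :=
    hθ.comp (by fun_prop)
  have t2 : Differentiable ℂ fun lam : ℂ => theta1 (z₁ - z₂ - (lam + κ) / n + κ) τ :=
    hθ.comp (by fun_prop)
  have t3 : Differentiable ℂ fun lam : ℂ => theta1 (z₁ - z₂ - (lam + κ) / n) τ :=
    hθ.comp (by fun_prop)
  unfold kernelDefect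
  fun_prop

theorem differentiable_kernelDefect_fst {n : ℕ} [NeZero n] (τ : ℍ) (κ : ℂ) (i j : ZMod n)
    (z₂ lam : ℂ) : Differentiable ℂ fun z₁ => kernelDefect n τ κ i j z₁ z₂ lam := by
  have hθ := differentiable_theta1 τ
  have hψ := fun a : ZMod n => differentiable_psi τ a
  have t1 : Differentiable ℂ fun z₁ : ℂ => theta1 (z₁ - z₂ - (lam + κ) / n + lam) τ :=
    hθ.comp (by fun_prop)
  have t2 : Differentiable ℂ fun z₁ : ℂ => theta1 (z₁ - z₂ - (lam + κ) / n + κ) τ :=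
    hθ.comp (by fun_prop)
  have t3 : Differentiable ℂ fun z₁ : ℂ => theta1 (z₁ - z₂ - (lam + κ) / n) τ :=
    hθ.comp (by fun_prop)
  unfold kernelDefect
  fun_prop

/-- For generic `z₁, z₂` the quotient of the defect by `θ(lam) θ(z₁ - z₂ - (lam + κ)/n)` is an
entire function of `lam` with the multipliers `1`, `e(κ)` along `n`, `nτ`. -/
theorem kernelDefect_eq_zero_of_generic {n : ℕ} [NeZero n] {τ : ℍ} {κ : ℂ}
    (hκ : κ ∉ periodLattice τ) (i j : ZMod n) {z₁ z₂ : ℂ}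
    (hz : theta1 (n * (z₁ - z₂) - κ) τ ≠ 0) (lam : ℂ) :
    kernelDefect n τ κ i j z₁ z₂ lam = 0 := by
  have hn : (n : ℂ) ≠ 0 := NeZero.ne _
  have hθ := differentiable_theta1 τ
  -- in the variable `μ = lam/n` the periods are `1`, `τ`, and `w = c - μ`
  set c : ℂ := z₁ - z₂ - κ / n with hc
  have hw : ∀ μ : ℂ, z₁ - z₂ - (n * μ + κ) / n = c - μ := fun μ => by
    rw [hc]; field_simp; ring
  have hu : Differentiable ℂ fun μ : ℂ => theta1 (n * μ) τ := hθ.comp (by fun_prop)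
  have hv : Differentiable ℂ fun μ : ℂ => theta1 (c - μ) τ := hθ.comp (by fun_prop)
  have hpow : (-1 : ℂ) ^ n = -(-1) ^ (n - 1) := by
    obtain ⟨m, hm⟩ : ∃ m, n = m + 1 := Nat.exists_eq_succ_of_ne_zero (NeZero.ne n)
    rw [hm, pow_succ]; simp
  have hdisj : ∀ μ : ℂ, theta1 (n * μ) τ = 0 → theta1 (c - μ) τ ≠ 0 := by
    intro μ h1 h2
    obtain ⟨a, b, h1⟩ := (theta1_eq_zero_iff τ.im_pos).1 h1
    obtain ⟨a', b', h2⟩ := (theta1_eq_zero_iff τ.im_pos).1 h2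
    refine hz ((theta1_eq_zero_iff τ.im_pos).2 ⟨n * a' + a, n * b' + b, ?_⟩)
    have h3 : n * (z₁ - z₂) - κ = n * c := by rw [hc]; field_simp
    rw [h3]
    push_cast
    linear_combination n * h2 + h1
  have hder : ∀ μ, HasDerivAt (fun μ : ℂ => theta1 (n * μ) τ * theta1 (c - μ) τ)
      (n * deriv (fun z => theta1 z τ) (n * μ) * theta1 (c - μ) τ -
        theta1 (n * μ) τ * deriv (fun z => theta1 z τ) (c - μ)) μ := by
    intro μ
    have d1 : HasDerivAt (fun μ : ℂ => theta1 (n * μ) τ)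
        (deriv (fun z => theta1 z τ) (n * μ) * n) μ :=
      (hθ (n * μ)).hasDerivAt.comp μ (by simpa using (hasDerivAt_id μ).const_mul (n : ℂ))
    have d2 : HasDerivAt (fun μ : ℂ => theta1 (c - μ) τ)
        (deriv (fun z => theta1 z τ) (c - μ) * -1) μ :=
      (hθ (c - μ)).hasDerivAt.comp μ (by simpa using (hasDerivAt_id μ).const_sub c)
    exact (d1.fun_mul d2).congr_deriv (by ring)
  have hdf : Differentiable ℂ fun μ : ℂ => kernelDefect n τ κ i j z₁ z₂ (n * μ) :=
    (differentiable_kernelDefect_lam τ κ i j z₁ z₂).comp (by fun_prop)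
  have key := eq_zero_of_proportional_multipliers (σ := τ) (p := 0) (q := κ) τ.im_pos
    (fun N M h => hκ ⟨-M, N, by push_cast; linear_combination -h⟩)
    (f := fun μ => kernelDefect n τ κ i j z₁ z₂ (n * μ))
    (g := fun μ => theta1 (n * μ) τ * theta1 (c - μ) τ)
    hdf (hu.mul hv)
    (by
      by_contra! hcon
      obtain ⟨y, hy⟩ := exists_theta1_ne_zero τ.im_pos
      have := eq_zero_of_mul_eq_zero_entire hv hu ⟨y / n, by rwa [mul_div_cancel₀ _ hn]⟩ hcon
        (c - y)
      rw [sub_sub_cancel] at this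
      exact hy this)
    (fun μ h => by
      rcases mul_eq_zero.1 h with h | h
      · exact kernelDefect_eq_zero_of_lattice hκ i j z₁ z₂ h
      · exact kernelDefect_eq_zero_of_diagonal τ κ i j (by rwa [hw]))
    (fun μ h => by
      rw [(hder μ).deriv]
      rcases mul_eq_zero.1 h with h | h
      · rw [h, zero_mul, sub_zero]
        exact mul_ne_zero (mul_ne_zero hn (deriv_theta1_ne_zero τ.im_pos h)) (hdisj μ h)
      · rw [h, mul_zero, zero_sub]
        exact neg_ne_zero.2 (mul_ne_zero (fun h' => hdisj μ h' h)
          (deriv_theta1_ne_zero τ.im_pos h)))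
    (fun μ => by
      have h1 : (n : ℂ) * (μ + 1) = n * μ + n := by ring
      have h2 : c - (μ + 1) = c - μ - 1 := by ring
      rw [h1, h2, kernelDefect_add_period, theta1_add_nat, theta1_sub_one, hpow, e_zero]
      ring)
    (fun μ => by
      have h1 : (n : ℂ) * (μ + τ) = n * μ + n * τ := by ring
      have h2 : theta1 (c - μ) τ = -e (-τ / 2 - (c - (μ + τ))) * theta1 (c - (μ + τ)) τ := by
        rw [← theta1_add_tau]; congr 1; ring
      have h3 : e κ * e (-n ^ 2 * τ / 2 - n * (n * μ)) =
          e (-n ^ 2 * τ / 2 - n * (n * μ) + κ - τ / 2 + (c - μ)) *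
            e (-τ / 2 - (c - (μ + τ))) := by
        rw [← e_add, ← e_add]; congr 1; ring
      rw [h1, kernelDefect_add_period_tau, theta1_add_nat_mul, hw, h2]
      linear_combination -(-1) ^ n * kernelDefect n τ κ i j z₁ z₂ (n * μ) * theta1 (n * μ) τ *
        theta1 (c - (μ + τ)) τ * h3)
    (lam / n)
  rwa [mul_div_cancel₀ _ hn] at key

/-- The action of the operator on `ψ_i ⊗ ψ_j`, with denominators cleared. -/
theorem kernelDefect_eq_zero {n : ℕ} [NeZero n] {τ : ℍ} {κ : ℂ}
    (hκ : κ ∉ periodLattice τ) (i j : ZMod n) (z₁ z₂ lam : ℂ) :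
    kernelDefect n τ κ i j z₁ z₂ lam = 0 := by
  have hn : (n : ℂ) ≠ 0 := NeZero.ne _
  refine eq_zero_of_mul_eq_zero_entire (g := fun z => theta1 (n * (z - z₂) - κ) τ)
    (differentiable_kernelDefect_fst τ κ i j z₂ lam)
    ((differentiable_theta1 τ).comp (by fun_prop : Differentiable ℂ fun z => n * (z - z₂) - κ))
    ?_ (fun z => ?_) z₁
  · obtain ⟨y, hy⟩ := exists_theta1_ne_zero τ.im_pos
    refine ⟨(y + κ) / n + z₂, ?_⟩
    rwa [add_sub_cancel_right, mul_div_cancel₀ _ hn, add_sub_cancel_right]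
  · by_cases h : theta1 (n * (z - z₂) - κ) τ = 0
    · rw [h, zero_mul]
    · rw [kernelDefect_eq_zero_of_generic hκ i j h, mul_zero]

/-! ### The coefficients with modulus `nτ` -/

/-- The theta function `θ_{x/n + 1/2, 1/2}(z, nτ)` for `x ∈ ℤ/n`. -/
def residueTheta (n : ℕ) (τ : ℍ) (x : ZMod n) (z : ℂ) : ℂ :=
  thetaChar ((x.val : ℚ) / n + 1 / 2) (1 / 2) z (n * τ)

theorem thetaChar_eq_residueTheta {n : ℕ} [NeZero n] (τ : ℍ) (x : ℤ) (z : ℂ) :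
    thetaChar ((x : ℚ) / n + 1 / 2) (1 / 2) z (n * τ) = residueTheta n τ x z := by
  have hn : (n : ℚ) ≠ 0 := NeZero.ne _
  have hper : Function.Periodic (fun a : ℚ => thetaChar a (1 / 2) z (n * τ)) 1 :=
    fun a => thetaChar_add_char a (1 / 2) z (n * τ)
  have h1 : ((x : ZMod n).val : ℤ) = x % n := ZMod.val_intCast x
  have h2 : (x : ℚ) = ((x : ZMod n).val : ℚ) + n * (x / n : ℤ) := by
    have : ((x : ZMod n).val : ℤ) + n * (x / n) = x := by rw [h1]; exact Int.emod_add_mul_ediv x n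
    exact_mod_cast this.symm
  have h3 : (x : ℚ) / n + 1 / 2 = ((x : ZMod n).val : ℚ) / n + 1 / 2 + (x / n : ℤ) * 1 := by
    conv_lhs => rw [h2]
    field_simp
    ring
  rw [h3]
  exact hper.int_mul (x / n) _

theorem differentiable_residueTheta {n : ℕ} [NeZero n] (τ : ℍ) (x : ZMod n) :
    Differentiable ℂ (residueTheta n τ x) :=
  differentiable_thetaChar _ _ (im_nat_mul_pos n τ)

theorem residueTheta_add_one {n : ℕ} [NeZero n] (τ : ℍ) (x : ZMod n) (z : ℂ) :
    residueTheta n τ x (z + 1) = -ZMod.stdAddChar x * residueTheta n τ x z := by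
  have h : e (((x.val : ℚ) / n + 1 / 2 : ℚ) : ℂ) = -ZMod.stdAddChar x := by
    push_cast
    rw [e_add, e_half, stdAddChar_eq, mul_neg_one]
  rw [residueTheta, thetaChar_add_one, h]
  rfl

theorem residueTheta_add_tau {n : ℕ} [NeZero n] (τ : ℍ) (x : ZMod n) (z : ℂ) :
    residueTheta n τ x (z + τ) =
      e (-τ / (2 * n) - (z + 1 / 2) / n) * residueTheta n τ (x + 1) z := by
  have hn : (n : ℂ) ≠ 0 := NeZero.ne _
  have h : ((x.val + 1 : ℤ) : ZMod n) = x + 1 := by simp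
  rw [← h, ← thetaChar_eq_residueTheta, residueTheta]
  simp only [thetaChar]
  rw [← tsum_mul_left]
  refine tsum_congr fun m => ?_
  rw [e, ← Complex.exp_add]
  congr 1
  push_cast
  field_simp
  ring

theorem residueTheta_eq_zero {n : ℕ} [NeZero n] {τ : ℍ} {x : ZMod n} {z : ℂ}
    (h : residueTheta n τ x z = 0) : ∃ k l : ℤ, z = k + (n * l - x.val : ℤ) * τ := by
  have hn : (n : ℂ) ≠ 0 := NeZero.ne _
  obtain ⟨k, l, hkl⟩ := (thetaChar_eq_zero_iff (im_nat_mul_pos n τ)).1 h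
  refine ⟨k, l, ?_⟩
  push_cast at hkl ⊢
  field_simp at hkl
  linear_combination hkl / 2

theorem deriv_residueTheta_ne_zero {n : ℕ} [NeZero n] {τ : ℍ} {x : ZMod n} {z : ℂ}
    (h : residueTheta n τ x z = 0) : deriv (residueTheta n τ x) z ≠ 0 := by
  have hσ := im_nat_mul_pos n τ
  set s : ℂ := (((x.val : ℚ) / n + 1 / 2 : ℚ) : ℂ) - 1 / 2 with hs
  set b : ℂ := ((1 / 2 : ℚ) : ℂ) with hb
  have hfun : residueTheta n τ x = fun z =>
      -e (s ^ 2 * (n * τ) / 2 + s * (z + b)) *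
        theta1 (z + (b - 1 / 2) + s * (n * τ)) (n * τ) := funext fun z => thetaChar_eq _ _ z _
  rw [hfun, mul_eq_zero, neg_eq_zero, or_iff_right (e_ne_zero _)] at h
  have d1 : DifferentiableAt ℂ (fun z => -e (s ^ 2 * (n * τ) / 2 + s * (z + b))) z :=
    (by fun_prop : Differentiable ℂ fun z => -e (s ^ 2 * (n * τ) / 2 + s * (z + b))) z
  have d2 : HasDerivAt (fun z => theta1 (z + (b - 1 / 2) + s * (n * τ)) (n * τ))
      (deriv (fun z => theta1 z (n * τ)) (z + (b - 1 / 2) + s * (n * τ)) * 1) z :=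
    (differentiable_theta1_of_im_pos hσ _).hasDerivAt.comp z
      (((hasDerivAt_id z).add_const _).add_const _)
  rw [hfun, (d1.hasDerivAt.fun_mul d2).deriv, h, mul_zero, zero_add, mul_one]
  exact mul_ne_zero (neg_ne_zero.2 (e_ne_zero _)) (deriv_theta1_ne_zero hσ h)

theorem residueTheta_neg_ne_zero {n : ℕ} [NeZero n] {τ : ℍ} {z : ℂ}
    (hz : z ∉ periodLattice τ) (x : ZMod n) : residueTheta n τ x (-z) ≠ 0 := by
  intro h
  obtain ⟨k, l, hkl⟩ := residueTheta_eq_zero h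
  exact hz ⟨-k, -(n * l - x.val), by push_cast at hkl ⊢; linear_combination -hkl⟩

theorem residueTheta_ne_zero {n : ℕ} [NeZero n] {τ : ℍ} {z : ℂ}
    (hz : z ∉ periodLattice τ) (x : ZMod n) : residueTheta n τ x z ≠ 0 := by
  intro h
  obtain ⟨k, l, hkl⟩ := residueTheta_eq_zero h
  exact hz ⟨k, _, hkl⟩

theorem residueTheta_zero_ne_zero {n : ℕ} [NeZero n] (τ : ℍ) {x : ZMod n} (hx : x ≠ 0) :
    residueTheta n τ x 0 ≠ 0 := by
  intro h
  obtain ⟨k, l, hkl⟩ := residueTheta_eq_zero h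
  have him := congrArg Complex.im hkl
  simp only [zero_im, add_im, intCast_im, mul_im, intCast_re, zero_mul, zero_add, add_zero] at him
  have h1 : ((n * l - x.val : ℤ) : ℝ) = 0 := (mul_eq_zero.1 him.symm).resolve_right τ.im_pos.ne'
  have h2 : (x.val : ℤ) = n * l := by
    have : (n * l - x.val : ℤ) = 0 := by exact_mod_cast h1
    linarith
  apply hx
  have h3 : ((x.val : ℤ) : ZMod n) = ((n * l : ℤ) : ZMod n) := congrArg _ h2
  simpa using h3

theorem residueTheta_zero_zero {n : ℕ} [NeZero n] (τ : ℍ) : residueTheta n τ 0 0 = 0 := by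
  rw [residueTheta, thetaChar_eq_zero_iff (im_nat_mul_pos n τ)]
  exact ⟨0, 0, by simp⟩

theorem exists_residueTheta_quotient {n : ℕ} [NeZero n] (τ : ℍ) (x : ZMod n) :
    ∃ h : ℂ → ℂ, Differentiable ℂ h ∧ ∀ z, theta1 z τ = residueTheta n τ x z * h z :=
  exists_entire_quotient (differentiable_theta1 τ) (differentiable_residueTheta τ x)
    (fun z hz => by
      obtain ⟨k, l, rfl⟩ := residueTheta_eq_zero hz
      exact theta1_lattice τ k _)
    (fun z hz => deriv_residueTheta_ne_zero hz)

theorem exists_residueTheta_ne_zero {n : ℕ} [NeZero n] (τ : ℍ) (x : ZMod n) :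
    ∃ z, residueTheta n τ x z ≠ 0 := exists_thetaChar_ne_zero _ _ (im_nat_mul_pos n τ)

/-- Both sides, multiplied by `θ(lam)`, are families of theta functions in `lam` with the same
multipliers and the same value at `lam = 0`. -/
theorem residueTheta_quotient_eq_belavinEntry {n : ℕ} [NeZero n] {τ : ℍ} {κ : ℂ}
    (hκ : κ ∉ periodLattice τ) {lam : ℂ} (hlam : lam ∉ periodLattice τ) (d m : ZMod n) :
    deriv (residueTheta n τ 0) 0 * residueTheta n τ (m + d) (lam - κ) /
      (residueTheta n τ d (-κ) * residueTheta n τ m lam) =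
    deriv (fun z => theta1 z τ) 0 / theta1 lam τ * belavinEntry n τ κ d m lam := by
  have hn : (n : ℂ) ≠ 0 := NeZero.ne _
  -- with `q x = θ / θ_{x/n + 1/2, 1/2}(·, nτ)` the denominators depending on `lam` disappear
  choose q hqd hq using fun x : ZMod n => exists_residueTheta_quotient τ x
  have hvd := fun x : ZMod n => differentiable_residueTheta τ x
  have hbd := fun a b : ZMod n => differentiable_belavinEntry τ κ a b
  have q1 : ∀ x z, ZMod.stdAddChar x * q x (z + 1) = q x z := fun x =>
    eq_of_mul_eq_mul_entire (g := residueTheta n τ x)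
      (((hqd x).comp (by fun_prop : Differentiable ℂ fun z : ℂ => z + 1)).const_mul _) (hqd x)
      (hvd x) (exists_residueTheta_ne_zero τ x) fun z => by
        have h := hq x (z + 1)
        rw [theta1_add_one, residueTheta_add_one, hq x z] at h
        linear_combination h
  have q2 : ∀ x z, q x (z + τ) =
      -e (-τ / 2 - z + τ / (2 * n) + (z + 1 / 2) / n) * q (x + 1) z := fun x =>
    eq_of_mul_eq_mul_entire (g := residueTheta n τ (x + 1))
      ((hqd x).comp (by fun_prop : Differentiable ℂ fun z : ℂ => z + (τ : ℂ)))
      ((by fun_prop : Differentiable ℂ fun z =>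
        -e (-τ / 2 - z + τ / (2 * n) + (z + 1 / 2) / n)).mul (hqd (x + 1)))
      (hvd (x + 1)) (exists_residueTheta_ne_zero τ (x + 1)) fun z => by
        have h := hq x (z + τ)
        rw [theta1_add_tau, residueTheta_add_tau, hq (x + 1) z] at h
        have h2 : e (-τ / 2 - z) = e (-τ / (2 * n) - (z + 1 / 2) / n) *
            e (-τ / 2 - z + τ / (2 * n) + (z + 1 / 2) / n) := by
          rw [← e_add]; congr 1; ring
        rw [h2] at h
        apply mul_left_cancel₀ (e_ne_zero (-τ / (2 * n) - (z + 1 / 2) / n))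
        linear_combination -h
  have key := eq_zero_of_theta_family (n := n) (σ := τ) (p := d.val / n) (q := κ / n) τ.im_pos
    (fun N M h => hκ ⟨-M, d.val + n * N, by
      field_simp at h
      push_cast
      linear_combination -h⟩)
    (D := fun m lam => deriv (residueTheta n τ 0) 0 *
        (residueTheta n τ (m + d) (lam - κ) * q m lam) -
      deriv (fun z => theta1 z τ) 0 * residueTheta n τ d (-κ) * belavinEntry n τ κ d m lam)
    (fun m => by fun_prop)
    (fun m z => by
      have h1 : q m z = ZMod.stdAddChar m * q m (z + 1) := (q1 m z).symm
      have h2 : z + 1 - κ = z - κ + 1 := by ring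
      rw [h2, residueTheta_add_one, belavinEntry_add_one, h1, ← stdAddChar_eq,
        AddChar.map_add_eq_mul]
      ring)
    (fun m z => by
      have h2 : z + τ - κ = z - κ + τ := by ring
      have h3 : e (-τ / 2 - z + κ / n) = e (-τ / (2 * n) - (z - κ + 1 / 2) / n) *
          e (-τ / 2 - z + τ / (2 * n) + (z + 1 / 2) / n) := by
        rw [← e_add]; congr 1; ring
      rw [h2, residueTheta_add_tau, belavinEntry_add_tau, q2, add_right_comm m d 1]
      linear_combination deriv (residueTheta n τ 0) 0 *
        (residueTheta n τ (m + 1 + d) (z - κ) * q (m + 1) z) * h3)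
    (fun m => by
      rw [belavinEntry_zero hκ]
      by_cases hm : m = 0
      · subst hm
        have hfun : (fun z => theta1 z τ) = fun z => residueTheta n τ 0 z * q 0 z := funext (hq 0)
        rw [hfun, ((hvd 0 0).hasDerivAt.fun_mul (hqd 0 0).hasDerivAt).deriv,
          residueTheta_zero_zero, if_pos rfl]
        simp only [zero_add, zero_sub]
        ring
      · have h := hq m 0
        rw [theta1_zero, eq_comm, mul_eq_zero,
          or_iff_right (residueTheta_zero_ne_zero τ hm)] at h
        rw [h, if_neg hm]
        ring) m lam
  have h1 := residueTheta_neg_ne_zero hκ d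
  have h2 := residueTheta_ne_zero hlam m
  have h3 : q m lam ≠ 0 := by
    intro h
    exact hlam ((theta1_eq_zero_iff τ.im_pos).1 (by rw [hq m lam, h, mul_zero]))
  rw [hq m lam, div_mul_eq_mul_div, div_eq_div_iff (mul_ne_zero h1 h2) (mul_ne_zero h2 h3)]
  linear_combination residueTheta n τ m lam * key

/-- The matrix coefficients with modulus `nτ` are those of Belavin's matrix. -/
theorem ellipticCoeff_eq {n : ℕ} [NeZero n] {τ : ℍ} {κ : ℂ}
    (hκ : κ ∉ periodLattice τ) {lam : ℂ} (hlam : lam ∉ periodLattice τ) (i j k l : ZMod n) :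
    ellipticCoeff n τ κ lam i j k l = if i + j = k + l then
      deriv (fun z => theta1 z τ) 0 / theta1 lam τ * belavinEntry n τ κ (i - k) (k - j) lam
      else 0 := by
  have hd : (fun z => thetaChar (1 / 2) (1 / 2) z (n * τ)) = residueTheta n τ 0 := by
    funext z
    simp [residueTheta]
  have hc : ∀ (a b : ZMod n) (z : ℂ),
      thetaChar (((a.val : ℚ) - b.val) / n + 1 / 2) (1 / 2) z (n * τ) =
        residueTheta n τ (a - b) z := by
    intro a b z
    have h := thetaChar_eq_residueTheta (n := n) τ (a.val - b.val) z
    push_cast at h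
    simpa using h
  have hij : i - j = k - j + (i - k) := by ring
  rw [ellipticCoeff]
  split_ifs
  · rw [← residueTheta_quotient_eq_belavinEntry hκ hlam, hd, hc, hc, hc, hij]
  · rfl

/-! ### Belavin's matrix in coordinates -/

theorem clockMatrix_eq (n : ℕ) [NeZero n] :
    clockMatrix n = Matrix.diagonal fun a : ZMod n => (ZMod.stdAddChar a : ℂ) := by
  rw [clockMatrix]
  congr 1
  funext a
  rw [stdAddChar_eq, e, ← Complex.exp_nat_mul]
  congr 1
  ring

theorem shiftMatrix_pow (n : ℕ) [NeZero n] (q : ℕ) (r c : ZMod n) :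
    (shiftMatrix n ^ q) r c = if r = c - q then 1 else 0 := by
  induction q generalizing c with
  | zero => simp [Matrix.one_apply]
  | succ q ih =>
    rw [pow_succ, Matrix.mul_apply]
    have h : c - 1 - (q : ZMod n) = c - (q + 1 : ℕ) := by push_cast; ring
    have h1 : ∀ a b : ZMod n, shiftMatrix n a b = if a = b - 1 then 1 else 0 := fun _ _ => rfl
    simp only [ih, h1, mul_ite, mul_one, mul_zero]
    rw [Finset.sum_ite_eq' Finset.univ (c - 1), if_pos (Finset.mem_univ _), h]

theorem heisenberg_apply (n : ℕ) [NeZero n] (α : ZMod n × ZMod n) (r c : ZMod n) :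
    heisenberg n α r c = if r = c - α.2 then ZMod.stdAddChar (α.1 * r) else 0 := by
  have h : (ZMod.stdAddChar r : ℂ) ^ α.1.val = ZMod.stdAddChar (α.1 * r) := by
    rw [← AddChar.map_nsmul_eq_pow, nsmul_eq_mul, ZMod.natCast_zmod_val]
  rw [heisenberg, clockMatrix_eq, Matrix.diagonal_pow, Matrix.diagonal_mul, shiftMatrix_pow,
    ZMod.natCast_zmod_val, Pi.pow_apply, h]
  simp

theorem heisenberg_inv_apply (n : ℕ) [NeZero n] (α : ZMod n × ZMod n) (r c : ZMod n) :
    (heisenberg n α)⁻¹ r c = if r = c + α.2 then ZMod.stdAddChar (-(α.1 * c)) else 0 := by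
  have h : heisenberg n α * Matrix.of (fun r c : ZMod n =>
      if r = c + α.2 then (ZMod.stdAddChar (-(α.1 * c)) : ℂ) else 0) = 1 := by
    ext r c
    rw [Matrix.mul_apply]
    simp only [heisenberg_apply, Matrix.of_apply, mul_ite, mul_zero]
    rw [Finset.sum_ite_eq' Finset.univ (c + α.2), if_pos (Finset.mem_univ _),
      add_sub_cancel_right, Matrix.one_apply]
    split_ifs with hrc
    · rw [hrc, ← AddChar.map_add_eq_mul]; simp
    · rw [zero_mul]
  rw [Matrix.inv_eq_right_inv h, Matrix.of_apply]

theorem belavinR_apply (n : ℕ) [NeZero n] (τ : ℍ) (κ lam : ℂ) (i j k l : ZMod n) :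
    belavinR n τ (-κ / n) lam (k, l) (i, j) =
      if i + j = k + l then belavinEntry n τ κ (i - k) (k - j) lam else 0 := by
  have hterm : ∀ a b : ZMod n, (belavinWeight n τ (-κ / n) lam (a, b) •
      (heisenberg n (a, b) ⊗ₖ (heisenberg n (a, b))⁻¹)) (k, l) (i, j) =
      if b = i - k then (if i + j = k + l then
        ZMod.stdAddChar (a * (k - j)) * belavinWeight n τ (-κ / n) lam (a, i - k) else 0)
      else 0 := by
    intro a b
    have h1 : k = i - b ↔ b = i - k :=
      ⟨fun h => by rw [h]; ring, fun h => by rw [h]; ring⟩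
    rw [Matrix.smul_apply, Matrix.kroneckerMap_apply, heisenberg_apply, heisenberg_inv_apply,
      smul_eq_mul]
    simp only [h1]
    by_cases hb : b = i - k
    · have h2 : l = j + b ↔ i + j = k + l := by
        rw [hb]
        exact ⟨fun h => by rw [h]; ring, fun h => by linear_combination -h⟩
      simp only [h2, if_pos hb]
      split_ifs with h3
      · rw [← AddChar.map_add_eq_mul, ← hb, mul_comm]
        congr 2
        ring
      · simp
    · simp [if_neg hb]
  rw [belavinR, Matrix.sum_apply, Fintype.sum_prod_type]
  simp only [hterm]
  simp only [Finset.sum_ite_eq', Finset.mem_univ, if_true]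
  split_ifs
  · rfl
  · simp

/-! ### The operator on the meromorphic functions and the bases -/

/-- The entire function `ψ_a`. -/
def psiHolo (n : ℕ) [NeZero n] (τ : ℍ) (a : ZMod n) : Holo ℂ := ⟨psi n τ a, differentiable_psi τ a⟩

theorem psiHolo_mem (n : ℕ) [NeZero n] (τ : ℍ) (a : ZMod n) :
    psiHolo n τ a ∈ thetaSpace n τ := by
  refine ⟨psi_add_one τ a, fun z => ?_⟩
  have h : cexp (-π * I * n * τ - 2 * π * I * n * z) = e (-n * τ / 2 - n * z) := by
    rw [e]; congr 1; ring
  rw [h]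
  exact psi_add_tau τ a z

theorem exists_eq_sum_psiHolo {n : ℕ} [NeZero n] {τ : ℍ} {f : Holo ℂ} (hf : f ∈ thetaSpace n τ) :
    ∃ c : ZMod n → ℂ, f = ∑ a, c a • psiHolo n τ a := by
  obtain ⟨c, hc⟩ := exists_eq_sum_psi τ f.2 hf.1 (fun z => by
    have h : e (-n * τ / 2 - n * z) = cexp (-π * I * n * τ - 2 * π * I * n * z) := by
      rw [e]; congr 1; ring
    rw [h]
    exact hf.2 z)
  refine ⟨c, Subtype.ext (funext fun z => ?_)⟩
  rw [hc z]
  simp [psiHolo]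

theorem psiHolo_linearIndependent (n : ℕ) [NeZero n] (τ : ℍ) :
    LinearIndependent ℂ (psiHolo n τ) := by
  rw [Fintype.linearIndependent_iff]
  refine fun c hc => psi_linearIndependent τ c fun z => ?_
  have h := congrFun (congrArg Subtype.val hc) z
  simpa [psiHolo] using h

theorem thetaSpace_eq_span (n : ℕ) [NeZero n] (τ : ℍ) :
    thetaSpace n τ = Submodule.span ℂ (Set.range (psiHolo n τ)) := by
  refine le_antisymm (fun f hf => ?_) (Submodule.span_le.2 ?_)
  · obtain ⟨c, rfl⟩ := exists_eq_sum_psiHolo hf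
    exact Submodule.sum_mem _ fun a _ =>
      Submodule.smul_mem _ _ (Submodule.subset_span ⟨a, rfl⟩)
  · rintro _ ⟨a, rfl⟩
    exact psiHolo_mem n τ a

/-- The basis of the functions `ψ_a`. -/
def psiBasis (n : ℕ) [NeZero n] (τ : ℍ) : Module.Basis (ZMod n) ℂ (thetaSpace n τ) :=
  (Module.Basis.span (psiHolo_linearIndependent n τ)).map
    (LinearEquiv.ofEq _ _ (thetaSpace_eq_span n τ).symm)

theorem psiBasis_apply (n : ℕ) [NeZero n] (τ : ℍ) (a : ZMod n) :
    (psiBasis n τ a).1 = psiHolo n τ a := by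
  simp [psiBasis, Module.Basis.span_apply]

/-- The inclusion of the holomorphic functions into the meromorphic ones. -/
def holoToMero : Holo (ℂ × ℂ) →ₗ[ℂ] Mero (ℂ × ℂ) :=
  (IsScalarTower.toAlgHom ℂ (Holo (ℂ × ℂ)) (Mero (ℂ × ℂ))).toLinearMap

theorem holoToMero_apply (F : Holo (ℂ × ℂ)) :
    holoToMero F = algebraMap (Holo (ℂ × ℂ)) (Mero (ℂ × ℂ)) F := rfl

theorem holoToMero_injective : Function.Injective holoToMero :=
  IsFractionRing.injective (Holo (ℂ × ℂ)) (Mero (ℂ × ℂ))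

/-- The meromorphic function `ψ_a(z₁) ψ_b(z₂)`. -/
def psiTensor (n : ℕ) [NeZero n] (τ : ℍ) (p : ZMod n × ZMod n) : Mero (ℂ × ℂ) :=
  holoToMero (tensorFun (psiHolo n τ p.1) (psiHolo n τ p.2))

theorem psiTensor_linearIndependent (n : ℕ) [NeZero n] (τ : ℍ) :
    LinearIndependent ℂ (psiTensor n τ) := by
  have h : LinearIndependent ℂ fun p : ZMod n × ZMod n =>
      tensorFun (psiHolo n τ p.1) (psiHolo n τ p.2) := by
    rw [Fintype.linearIndependent_iff]
    rintro c hc ⟨a, b⟩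
    have hz : ∀ z₁ z₂, ∑ a, (∑ b, c (a, b) * psi n τ b z₂) * psi n τ a z₁ = 0 := by
      intro z₁ z₂
      have h := congrFun (congrArg Subtype.val hc) (z₁, z₂)
      simp only [AddSubmonoidClass.coe_finsetSum, Finset.sum_apply, Fintype.sum_prod_type] at h
      refine Eq.trans (Finset.sum_congr rfl fun a _ => ?_) h
      rw [Finset.sum_mul]
      refine Finset.sum_congr rfl fun b _ => ?_
      change _ = c (a, b) * (psi n τ a z₁ * psi n τ b z₂)
      ring
    exact psi_linearIndependent τ (fun b => c (a, b))
      (fun z₂ => psi_linearIndependent τ _ (fun z₁ => hz z₁ z₂) a) b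
  exact h.map' holoToMero (LinearMap.ker_eq_bot.2 holoToMero_injective)

theorem thetaTensor_eq_span (n : ℕ) [NeZero n] (τ : ℍ) :
    thetaTensor n τ = Submodule.span ℂ (Set.range (psiTensor n τ)) := by
  refine le_antisymm (Submodule.span_le.2 ?_) (Submodule.span_mono ?_)
  · rintro _ ⟨f, hf, g, hg, rfl⟩
    obtain ⟨c, rfl⟩ := exists_eq_sum_psiHolo hf
    obtain ⟨d, rfl⟩ := exists_eq_sum_psiHolo hg
    have h : tensorFun (∑ a, c a • psiHolo n τ a) (∑ b, d b • psiHolo n τ b) =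
        ∑ a, ∑ b, (c a * d b) • tensorFun (psiHolo n τ a) (psiHolo n τ b) := by
      refine Subtype.ext (funext fun z => ?_)
      simp [tensorFun, Finset.sum_mul_sum]
      exact Finset.sum_congr rfl fun a _ => Finset.sum_congr rfl fun b _ => by ring
    rw [h, ← holoToMero_apply]
    simp only [map_sum, map_smul]
    exact Submodule.sum_mem _ fun a _ => Submodule.sum_mem _ fun b _ =>
      Submodule.smul_mem _ _ (Submodule.subset_span ⟨(a, b), rfl⟩)
  · rintro _ ⟨⟨a, b⟩, rfl⟩
    exact ⟨_, psiHolo_mem n τ a, _, psiHolo_mem n τ b, rfl⟩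

/-- The basis of the functions `ψ_a ⊗ ψ_b`. -/
def tensorBasis (n : ℕ) [NeZero n] (τ : ℍ) :
    Module.Basis (ZMod n × ZMod n) ℂ (thetaTensor n τ) :=
  (Module.Basis.span (psiTensor_linearIndependent n τ)).map
    (LinearEquiv.ofEq _ _ (thetaTensor_eq_span n τ).symm)

theorem tensorBasis_apply (n : ℕ) [NeZero n] (τ : ℍ) (p : ZMod n × ZMod n) :
    (tensorBasis n τ p).1 = psiTensor n τ p := by
  simp [tensorBasis, Module.Basis.span_apply]

theorem Biholo.pullback_mul (φ : Biholo (ℂ × ℂ)) (x y : Mero (ℂ × ℂ)) :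
    φ.pullback (x * y) = φ.pullback x * φ.pullback y := by
  simp [Biholo.pullback]

theorem Biholo.pullback_algebraMap (φ : Biholo (ℂ × ℂ)) (f : Holo (ℂ × ℂ)) :
    φ.pullback (algebraMap (Holo (ℂ × ℂ)) (Mero (ℂ × ℂ)) f) =
      algebraMap (Holo (ℂ × ℂ)) (Mero (ℂ × ℂ)) (φ.compHolo f) := by
  simp [Biholo.pullback]

theorem diffArg_ne_zero (τ : ℍ) {c : ℂ} (hc : theta1 c τ ≠ 0) (t : ℂ) :
    (antiShift t).compHolo ((holoTheta1 τ).1 c • diffArg (holoTheta1 τ) 0) ≠ 0 := by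
  intro h
  obtain ⟨y, hy⟩ := exists_theta1_ne_zero τ.im_pos
  have h1 := congrFun (congrArg Subtype.val h) (y - 2 * t, 0)
  have h2 : theta1 c τ * theta1 (y - 2 * t + t - (0 - t) + 0) τ = 0 := h1
  have h3 : y - 2 * t + t - (0 - t) + 0 = y := by ring
  rw [h3] at h2
  exact (mul_ne_zero hc hy) h2

theorem ellipticOperator_psiTensor {n : ℕ} [NeZero n] {τ : ℍ} {κ : ℂ}
    (hκ : κ ∉ periodLattice τ) {lam : ℂ} (hlam : lam ∉ periodLattice τ) (i j : ZMod n) :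
    ellipticOperator n τ κ lam (psiTensor n τ (i, j)) =
      ∑ k, (deriv (fun z => theta1 z τ) 0 / theta1 lam τ *
        belavinEntry n τ κ (i - k) (k - j) lam) • psiTensor n τ (k, i + j - k) := by
  have hθκ : theta1 κ τ ≠ 0 := fun h => hκ ((theta1_eq_zero_iff τ.im_pos).1 h)
  have hθl : theta1 lam τ ≠ 0 := fun h => hlam ((theta1_eq_zero_iff τ.im_pos).1 h)
  have hn : (n : ℂ) ≠ 0 := NeZero.ne _
  set t : ℂ := 1 / (2 * n) * -lam - κ / (2 * n) with ht
  set s : ℂ := 1 / (2 * n) * lam - κ / (2 * n) with hs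
  have hinj : ∀ F : Holo (ℂ × ℂ), F ≠ 0 →
      algebraMap (Holo (ℂ × ℂ)) (Mero (ℂ × ℂ)) F ≠ 0 := fun F hF h =>
    hF (holoToMero_injective (by rw [holoToMero_apply, h, map_zero]))
  have d1 := hinj _ (diffArg_ne_zero τ hθl t)
  have d2 := hinj _ (diffArg_ne_zero τ hθκ t)
  have hR : ∑ k, (deriv (fun z => theta1 z τ) 0 / theta1 lam τ *
        belavinEntry n τ κ (i - k) (k - j) lam) • psiTensor n τ (k, i + j - k) =
      algebraMap (Holo (ℂ × ℂ)) (Mero (ℂ × ℂ))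
        (∑ k, (deriv (fun z => theta1 z τ) 0 / theta1 lam τ *
          belavinEntry n τ κ (i - k) (k - j) lam) •
            tensorFun (psiHolo n τ k) (psiHolo n τ (i + j - k))) := by
    rw [← holoToMero_apply]
    simp only [map_sum, map_smul]
    rfl
  rw [hR]
  simp only [ellipticOperator, twistedOperator, twist, suOperator, Module.End.mul_apply,
    LinearMap.sub_apply, LinearMap.mulLeft_apply, opShift, opP, psiTensor, kernelG,
    holoToMero_apply, map_sub, Biholo.pullback_mul, Biholo.pullback_algebraMap,
    Biholo.pullback_div]
  rw [← ht, ← hs, div_mul_eq_mul_div, div_mul_eq_mul_div, div_sub_div _ _ d1 d2,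
    div_eq_iff (mul_ne_zero d1 d2)]
  simp only [← map_mul, ← map_sub]
  congr 1
  refine Subtype.ext (funext fun z => ?_)
  have key := kernelDefect_eq_zero hκ i j z.1 z.2 lam
  have a1 : z.1 + t - (z.2 - t) = z.1 - z.2 - (lam + κ) / n := by
    rw [ht]; field_simp; ring
  have a2 : z.2 - t + s = z.2 + lam / n := by rw [ht, hs]; field_simp; ring
  have a3 : z.1 + t - s = z.1 - lam / n := by rw [ht, hs]; field_simp; ring
  have a4 : z.1 + t + s = z.1 - κ / n := by rw [ht, hs]; field_simp; ring
  have a5 : z.2 - t - s = z.2 + κ / n := by rw [ht, hs]; field_simp; ring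
  have hsum : (∑ k, (deriv (fun z => theta1 z τ) 0 / theta1 lam τ *
      belavinEntry n τ κ (i - k) (k - j) lam) •
        tensorFun (psiHolo n τ k) (psiHolo n τ (i + j - k))).1 z =
      deriv (fun z => theta1 z τ) 0 / theta1 lam τ *
        ∑ k, belavinEntry n τ κ (i - k) (k - j) lam *
          (psi n τ k z.1 * psi n τ (i + j - k) z.2) := by
    rw [AddSubmonoidClass.coe_finsetSum, Finset.sum_apply, Finset.mul_sum]
    refine Finset.sum_congr rfl fun k _ => ?_
    change _ * _ * (psi n τ k z.1 * psi n τ (i + j - k) z.2) = _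
    ring
  refine Eq.trans (b := deriv (fun z => theta1 z τ) 0 * theta1 (z.1 + t - (z.2 - t) + lam) τ *
      (psi n τ i (z.2 - t + s) * psi n τ j (z.1 + t - s)) *
      (theta1 κ τ * theta1 (z.1 + t - (z.2 - t) + 0) τ) -
    theta1 lam τ * theta1 (z.1 + t - (z.2 - t) + 0) τ *
      (deriv (fun z => theta1 z τ) 0 * theta1 (z.1 + t - (z.2 - t) + κ) τ *
        (psi n τ i (z.1 + t + s) * psi n τ j (z.2 - t - s)))) rfl ?_
  refine Eq.trans ?_ (b := (∑ k, (deriv (fun z => theta1 z τ) 0 / theta1 lam τ *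
      belavinEntry n τ κ (i - k) (k - j) lam) •
        tensorFun (psiHolo n τ k) (psiHolo n τ (i + j - k))).1 z *
      (theta1 lam τ * theta1 (z.1 + t - (z.2 - t) + 0) τ *
        (theta1 κ τ * theta1 (z.1 + t - (z.2 - t) + 0) τ))) rfl
  rw [hsum, a1, a2, a3, a4, a5, add_zero]
  rw [kernelDefect] at key
  generalize (∑ k, belavinEntry n τ κ (i - k) (k - j) lam *
    (psi n τ k z.1 * psi n τ (i + j - k) z.2)) = S at key ⊢
  have hr : deriv (fun z => theta1 z τ) 0 / theta1 lam τ * theta1 lam τ =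
    deriv (fun z => theta1 z τ) 0 := div_mul_cancel₀ _ hθl
  linear_combination deriv (fun z => theta1 z τ) 0 *
    theta1 (z.1 - z.2 - (lam + κ) / n) τ * key -
    S * theta1 (z.1 - z.2 - (lam + κ) / n) τ ^ 2 * theta1 κ τ * hr

theorem ellipticOperator_mem {n : ℕ} [NeZero n] {τ : ℍ} {κ : ℂ}
    (hκ : κ ∉ periodLattice τ) {lam : ℂ} (hlam : lam ∉ periodLattice τ)
    {f : Mero (ℂ × ℂ)} (hf : f ∈ thetaTensor n τ) :
    ellipticOperator n τ κ lam f ∈ thetaTensor n τ := by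
  suffices h : thetaTensor n τ ≤ (thetaTensor n τ).comap (ellipticOperator n τ κ lam) from h hf
  conv_lhs => rw [thetaTensor_eq_span]
  rw [Submodule.span_le]
  rintro _ ⟨⟨i, j⟩, rfl⟩
  rw [SetLike.mem_coe, Submodule.mem_comap, ellipticOperator_psiTensor hκ hlam]
  refine Submodule.sum_mem _ fun k _ => Submodule.smul_mem _ _ ?_
  rw [← tensorBasis_apply]
  exact (tensorBasis n τ _).2

theorem repr_sum_smul_apply {ι α M : Type*} [Fintype α] [DecidableEq ι] [AddCommGroup M]
    [Module ℂ M] (B : Module.Basis ι ℂ M) (c : α → ℂ) (g : α → ι) (p : ι) :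
    B.repr (∑ k, c k • B (g k)) p = ∑ k, if g k = p then c k else 0 := by
  simp [Finsupp.single_apply]

theorem toMatrix_ellipticOperator {n : ℕ} [NeZero n] {τ : ℍ} {κ : ℂ}
    (hκ : κ ∉ periodLattice τ) {lam : ℂ} (hlam : lam ∉ periodLattice τ)
    (hinv : ∀ f ∈ thetaTensor n τ, ellipticOperator n τ κ lam f ∈ thetaTensor n τ)
    (i j k l : ZMod n) :
    LinearMap.toMatrix (tensorBasis n τ) (tensorBasis n τ)
        ((ellipticOperator n τ κ lam).restrict hinv) (k, l) (i, j) =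
      if i + j = k + l then
        deriv (fun z => theta1 z τ) 0 / theta1 lam τ * belavinEntry n τ κ (i - k) (k - j) lam
      else 0 := by
  have h : (ellipticOperator n τ κ lam).restrict hinv (tensorBasis n τ (i, j)) =
      ∑ k, (deriv (fun z => theta1 z τ) 0 / theta1 lam τ *
        belavinEntry n τ κ (i - k) (k - j) lam) • tensorBasis n τ (k, i + j - k) := by
    refine Subtype.ext ?_
    rw [LinearMap.coe_restrict_apply, tensorBasis_apply, ellipticOperator_psiTensor hκ hlam]
    simp [tensorBasis_apply]
  rw [LinearMap.toMatrix_apply, h, repr_sum_smul_apply]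
  simp only [Prod.mk.injEq]
  rw [Finset.sum_eq_single k (fun b _ hb => if_neg fun h => hb h.1) (by simp)]
  have hiff : i + j - k = l ↔ i + j = k + l := sub_eq_iff_eq_add'
  simp [hiff]

end

end ShibukawaUeno

theorem mainTheorem1 (n : ℕ) [NeZero n] (τ : ℍ) (κ : ℂ)
    (hκ : κ ∉ ShibukawaUeno.periodLattice τ) :
    ∃ (hinv : ∀ lam : ℂ, lam ∉ ShibukawaUeno.periodLattice τ →
        ∀ f ∈ ShibukawaUeno.thetaTensor n τ,
          ShibukawaUeno.ellipticOperator n τ κ lam f ∈ ShibukawaUeno.thetaTensor n τ)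
      (ψ : Module.Basis (ZMod n) ℂ (ShibukawaUeno.thetaSpace n τ))
      (B : Module.Basis (ZMod n × ZMod n) ℂ (ShibukawaUeno.thetaTensor n τ)),
      -- `ψ` is the basis of the functions `ψ_a`, and `B` that of the `ψ_a ⊗ ψ_b`
      (∀ a z, (ψ a).1.1 z = ShibukawaUeno.psi n τ a z) ∧
      (∀ a b, (B (a, b)).1 =
        algebraMap (ShibukawaUeno.Holo (ℂ × ℂ)) (ShibukawaUeno.Mero (ℂ × ℂ))
          (ShibukawaUeno.tensorFun (ψ a).1 (ψ b).1)) ∧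
      -- the matrix coefficients: `R (ψ_i ⊗ ψ_j) = ∑ R_{ij}^{kl} ψ_k ⊗ ψ_l`
      (∀ (lam : ℂ) (hlam : lam ∉ ShibukawaUeno.periodLattice τ) (i j k l : ZMod n),
        LinearMap.toMatrix B B
            ((ShibukawaUeno.ellipticOperator n τ κ lam).restrict (hinv lam hlam)) (k, l) (i, j) =
          ShibukawaUeno.ellipticCoeff n τ κ lam i j k l) ∧
      -- equivalence with Belavin's matrix, by a change of basis that does not depend on `lam`
      (∃ A : Matrix.GeneralLinearGroup (ZMod n) ℂ,
        ∀ (lam : ℂ) (hlam : lam ∉ ShibukawaUeno.periodLattice τ),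
          LinearMap.toMatrix B B
              ((ShibukawaUeno.ellipticOperator n τ κ lam).restrict (hinv lam hlam)) =
            (deriv (fun z => ShibukawaUeno.theta1 z τ) 0 / ShibukawaUeno.theta1 lam τ) •
              ((A.1 ⊗ₖ A.1) * ShibukawaUeno.belavinR n τ (-κ / n) lam * (A.1 ⊗ₖ A.1)⁻¹)) := by
  open ShibukawaUeno in
  -- the two matrices coincide up to the scalar, so the change of basis is the identity
  refine ⟨fun lam hlam f hf => ellipticOperator_mem hκ hlam hf, psiBasis n τ, tensorBasis n τ,
    fun a z => ?_, fun a b => ?_, fun lam hlam i j k l => ?_, 1, fun lam hlam => ?_⟩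
  · rw [psiBasis_apply]
    rfl
  · rw [tensorBasis_apply, psiBasis_apply, psiBasis_apply]
    rfl
  · rw [toMatrix_ellipticOperator hκ hlam, ellipticCoeff_eq hκ hlam]
  · ext ⟨k, l⟩ ⟨i, j⟩
    rw [toMatrix_ellipticOperator hκ hlam, Matrix.smul_apply, Units.val_one,
      Matrix.one_kronecker_one, inv_one, one_mul, mul_one, belavinR_apply, smul_eq_mul,
      mul_ite, mul_zero]
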